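/- Fix an even integer $k\ge 2$ and constants $A,a,\beta>0$. There are constants $C,c,C'>0$ and $p\in\mathbb N$, depending only on $k,A,a,\beta$, such that the following holds for all integers $n\ge k$ and $k/2\le \ell\le n$, and all real $m\geq 0$ with $$\frac mn\le A\,(n/\ell)^{(k-2)/2}\ln n\qquad\text{and}\qquad m\ge a\,\ell\ln n .$$ **Setting.** A $k$XOR instance $\mathcal I$ over $[n]$ is a finite multiset of constraints $(S,b)$ with $S\in\binom{[n]}{k}$ and $b\in\{\pm1\}$. For $z\in\{\pm1\}^n$ and $\rho\in[0,1]$, the Poissonized planted distribution $\widetilde{\mathcal P}^z_{n,k}(m,\rho)$ draws $\mathbf m\sim\mathrm{Poi}(m)$ and then $\mathbf m$ independent constraints $(S,\eta\prod_{i\in S}z_i)$, with $S$ uniform in $\binom{[n]}{k}$ and $\eta\in\{\pm1\}$ independent of $S$ with mean $\rho$. The Kikuchi matrix $\mathcal K_\ell(\mathcal I)$ is indexed by $\binom{[n]}{\ell}$ and has $(T,U)$ entry $\sum_{(S,b)\in\mathcal I,\;S=T\triangle U} b$. A matrix is $s$-sparse if each row and each column has at most $s$ nonzero entries. Call $\mathcal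 I$ *good* if $\mathcal K_\ell(\mathcal I)$ is $s$-sparse for some integer $s\le C\ell\ln n$ and $\mathcal I$ has at most $Cm$ constraints (counted with multiplicity). **(1)** For all $z\in\{\pm1\}^n$ and $\rho\in[0,1]$, an instance $\mathcal I\sim\widetilde{\mathcal P}^z_{n,k}(m,\rho)$ is good except with probability at most $n^{-c\ell}$. **(2)** Let $\mathcal I$ be any good instance and $\Lambda>0$ any real number with $|\mathcal K_\ell(\mathcal I)_{T,U}|\le\Lambda$ for all $T,U$. Let $N=\ell\lceil\log_2 n\rceil$, represent $T\in\binom{[n]}{\ell}$ by the $N$-bit string that lists its elements in increasing order in binary, and let $H$ be the Hamiltonian on $N$ qubits that equals $\mathcal K_\ell(\mathcal I)/\Lambda$ on these strings and has all other entries zero. Then each of the following oracles is implemented exactly by a quantum circuit of arbitrary one- and two-qubit gates (with ancillas that start and end in $|0\rangle$) with at most $$C'\,X\,\bigl(\ln(X+2)\bigr)^{p}\ \text{ gates},\quad X=m\,\ell\ln n,\qquad\text{on at most } C'\,\ell\ln n\ \text{ qubits, ancillas included:}$$ * for every integer $0\le b\le\beta\,\ell\ln n$, the adjacency matrix oracle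 $O_H|i,j,y\rangle=|i,j,y\oplus\mathrm{round}_b(H_{ij})\rangle$ for all $i,j\in\{0,1\}^N$ and $y\in\{0,1\}^{b+2}$, where $\mathrm{round}_b(H_{ij})$ is the nearest integer to $2^bH_{ij}$ in two's complement on $b+2$ bits; * for every integer $s\le \min(C\ell\ln n,\,2^N)$ such that $\mathcal K_\ell(\mathcal I)$ is $s$-sparse, an adjacency list oracle $O_F|i,k'\rangle=|i,f(i,k')\rangle$ for all $i\in\{0,1\}^N$ and $0\le k'<s$, for some $f:\{0,1\}^N\times\{0,\dots,s-1\}\to\{0,1\}\times\{0,1\}^N$ such that: $f(i,\cdot)$ is injective for each $i$; whenever $H_{ij}\ne0$ there is a unique $k'$ with $f(i,k')=(0,j)$; and $f(i,k')=(1,k'')$ implies $k''=k'$. Here the second register has $N+1$ qubits, and on input it holds a flag $0$ followed by $k'$ in binary. -/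

import Mathlib

open scoped NNReal ENNReal symmDiff

namespace Kikuchi

noncomputable section

/-! ## XOR instances and the planted, Poissonized distribution -/

/-- The `k`-element subsets of `[n]`. -/
abbrev KSubset (n k : ℕ) : Type := {S : Finset (Fin n) // S.card = k}

/-- A constraint: a scope of cardinality `k` and a right-hand side `±1`. -/
abbrev XORConstraint (n k : ℕ) : Type := KSubset n k × ℤˣ

/-- A `k`XOR instance over `[n]` is a finite multiset of constraints. -/
abbrev XORInstance (n k : ℕ) : Type := Multiset (XORConstraint n k)

theorem kSubset_nonempty {n k : ℕ} (hkn : k ≤ n) : Nonempty (KSubset n k) := by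
  obtain ⟨S, -, hS⟩ := Finset.exists_subset_card_eq
    (s := (Finset.univ : Finset (Fin n))) (n := k) (by simpa using hkn)
  exact ⟨⟨S, hS⟩⟩

/-- The uniform distribution on scopes. -/
def scopeLaw {n k : ℕ} (hkn : k ≤ n) : PMF (KSubset n k) :=
  haveI := kSubset_nonempty hkn
  PMF.uniformOfFintype (KSubset n k)

/-- The `±1`-valued law with mean `ρ`: the value `1` has probability `(1 + ρ) / 2`. -/
def noiseLaw (ρ : unitInterval) : PMF ℤˣ :=
  ((ProbabilityTheory.bernoulliMeasure true false
    ⟨(1 + (ρ : ℝ)) / 2, by have := ρ.2.1; linarith, by have := ρ.2.2; linarith⟩).toPMF).map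
    fun x => if x then 1 else -1

/-- One planted noisy constraint `(S, η · z^S)`, with `S` uniform and `η` an independent sign of
mean `ρ`. -/
def constraintLaw {n k : ℕ} (hkn : k ≤ n) (z : Fin n → ℤˣ) (ρ : unitInterval) :
    PMF (XORConstraint n k) :=
  (scopeLaw hkn).bind fun S => (noiseLaw ρ).map fun η => (S, η * ∏ i ∈ S.1, z i)

/-- The multiset of `t` independent samples from `p`. -/
def iidMultiset {α : Type} (p : PMF α) : ℕ → PMF (Multiset α)
  | 0 => PMF.pure 0
  | t + 1 => p.bind fun c => (iidMultiset p t).map fun I => c ::ₘ I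

/-- The planted noisy `k`XOR distribution with exactly `t` constraints. -/
def planted {n k : ℕ} (hkn : k ≤ n) (z : Fin n → ℤˣ) (ρ : unitInterval) (t : ℕ) :
    PMF (XORInstance n k) :=
  iidMultiset (constraintLaw hkn z ρ) t

/-- The Poissonized planted noisy `k`XOR distribution: first draw the number of constraints from
`Poi(m)`, then draw a planted instance with that many constraints. -/
def plantedPoisson {n k : ℕ} (hkn : k ≤ n) (z : Fin n → ℤˣ) (m : ℝ≥0) (ρ : unitInterval) :
    PMF (XORInstance n k) :=
  (ProbabilityTheory.poissonMeasure m).toPMF.bind (planted hkn z ρ)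

/-! ## The Kikuchi matrix and the Hamiltonian that it defines on qubits -/

/-- Adjacency matrix of the Kikuchi matching of `S`: the `ℓ`-subsets `T`, `U` are matched iff
`T ∆ U = S`. -/
def kikuchiMatching {n k : ℕ} (ℓ : ℕ) (S : KSubset n k) :
    Matrix (KSubset n ℓ) (KSubset n ℓ) ℤ :=
  Matrix.of fun T U => if T.1 ∆ U.1 = S.1 then 1 else 0

/-- The `ℓ`-Kikuchi matrix of an instance, `∑_{(S, b)} b · K_S`. -/
def kikuchiMatrix {n k : ℕ} (ℓ : ℕ) (I : XORInstance n k) :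
    Matrix (KSubset n ℓ) (KSubset n ℓ) ℤ :=
  (I.map fun c => (c.2 : ℤ) • kikuchiMatching ℓ c.1).sum

/-- A matrix is `s`-sparse if each row and each column has at most `s` nonzero entries. -/
def IsSparse {ι R : Type} [Fintype ι] [Zero R] (s : ℕ) (A : Matrix ι ι R) : Prop :=
  (∀ i, {j | A i j ≠ 0}.ncard ≤ s) ∧ (∀ j, {i | A i j ≠ 0}.ncard ≤ s)

/-- Strings of `N` bits: they label the computational basis of `N` qubits. -/
abbrev Bits (N : ℕ) : Type := Fin N → Bool

/-- The number `x`, in binary on `N` bits. -/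
def natBits (N x : ℕ) : Bits N := fun i => x.testBit i

/-- Number of qubits on which `ℓ`-subsets of `[n]` are stored: `ℓ` entries in `[n]`, each written
on `⌈log₂ n⌉` bits. -/
def numQubits (n ℓ : ℕ) : ℕ := ℓ * Nat.clog 2 n

/-- The bit string of an `ℓ`-subset: the sorted list of its elements, each one in binary. -/
def encodeSet {n ℓ : ℕ} (T : KSubset n ℓ) : Bits (numQubits n ℓ) := fun p =>
  natBits (Nat.clog 2 n) (T.1.orderEmbOfFin T.2 (finProdFinEquiv.symm p).1 : Fin n)
    (finProdFinEquiv.symm p).2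

/-- The Kikuchi matrix divided by `Λ`, as a Hamiltonian on `numQubits n ℓ` qubits. All entries in
rows or columns that are not the code of an `ℓ`-subset are zero. -/
def kikuchiHamiltonian {n k : ℕ} (ℓ : ℕ) (I : XORInstance n k) (Λ : ℝ) :
    Matrix (Bits (numQubits n ℓ)) (Bits (numQubits n ℓ)) ℝ :=
  Matrix.of fun x y => ∑ T : KSubset n ℓ, ∑ U : KSubset n ℓ,
    if encodeSet T = x ∧ encodeSet U = y then (kikuchiMatrix ℓ I T U : ℝ) / Λ else 0

/-! ## Quantum circuits -/

/-- A gate on qubits labelled by `W`: an arbitrary unitary on one qubit, or on two distinct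
qubits. -/
inductive Gate (W : Type) : Type
  | one (w : W) (G : Matrix.unitaryGroup Bool ℂ) : Gate W
  | two (v w : W) (hvw : v ≠ w) (G : Matrix.unitaryGroup (Bool × Bool) ℂ) : Gate W

open Classical in
/-- The action of a gate on the whole register: it acts on its own qubits and is the identity on
all the others. -/
def Gate.matrix {W : Type} : Gate W → Matrix (W → Bool) (W → Bool) ℂ
  | .one w G => Matrix.of fun x y =>
      if ∀ u, u ≠ w → x u = y u then (G : Matrix Bool Bool ℂ) (x w) (y w) else 0
  | .two v w _ G => Matrix.of fun x y =>
      if ∀ u, u ≠ v → u ≠ w → x u = y u then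
        (G : Matrix (Bool × Bool) (Bool × Bool) ℂ) (x v, x w) (y v, y w)
      else 0

/-- A quantum circuit is a list of gates; its gate complexity is the length of the list. -/
abbrev QCircuit (W : Type) : Type := List (Gate W)

/-- The state obtained when the gates of the circuit are applied in order to the state `ψ`. -/
def QCircuit.run {W : Type} [Fintype W] [DecidableEq W] (C : QCircuit W)
    (ψ : (W → Bool) → ℂ) : (W → Bool) → ℂ :=
  C.foldl (fun φ g => g.matrix.mulVec φ) ψ

/-- The computational basis state `|x⟩`. -/
def ket {W : Type} [DecidableEq W] [Fintype W] (x : W → Bool) : (W → Bool) → ℂ := Pi.single x 1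

/-- The basis state `|x⟩|0…0⟩` of a register `V` and `a` ancilla qubits. -/
def ketAnc {V : Type} [DecidableEq V] [Fintype V] (a : ℕ) (x : V → Bool) :
    (V ⊕ Fin a → Bool) → ℂ :=
  ket (Sum.elim x fun _ => false)

/-! ## The two oracles -/

/-- The `b`-bit approximation of `r ∈ [-1, 1]`: the nearest integer `v` to `2 ^ b * r`, which
represents the number `v / 2 ^ b` (within `2 ^ (-b)` of `r`), in two's complement. There are `b`
fractional bits, one bit for the integer part and one for the sign. -/
def roundBits (b : ℕ) (r : ℝ) : Bits (b + 2) := fun i =>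
  (BitVec.ofInt (b + 2) (round ((2 : ℝ) ^ b * r))).getLsbD i

/-- The circuit `C`, with `a` ancillas that start and end in `|0⟩`, implements the adjacency matrix
oracle `|i, j, z⟩ ↦ |i, j, z ⊕ round(H i j)⟩` with `b` bits of precision. -/
def ImplementsOH {N a : ℕ} (H : Matrix (Bits N) (Bits N) ℝ) (b : ℕ)
    (C : QCircuit ((Fin N ⊕ Fin N ⊕ Fin (b + 2)) ⊕ Fin a)) : Prop :=
  ∀ (i j : Bits N) (z : Bits (b + 2)),
    C.run (ketAnc a (Sum.elim i (Sum.elim j z))) =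
      ketAnc a (Sum.elim i (Sum.elim j fun p => xor (z p) (roundBits b (H i j) p)))

/-- `f` is an admissible adjacency list function for the `s`-sparse Hamiltonian `H`. The index
`k : Fin s` is identified with the `N`-bit string of the number `k`. -/
structure IsAdjacencyList {N s : ℕ} (H : Matrix (Bits N) (Bits N) ℝ)
    (f : Bits N → Fin s → Bool × Bits N) : Prop where
  injective : ∀ i k k', k ≠ k' → f i k ≠ f i k'
  covers : ∀ i j, H i j ≠ 0 → ∃! k, f i k = (false, j)
  dummy : ∀ i k k', f i k = (true, k') → k' = natBits N k

/-- The circuit `C`, with `a` ancillas that start and end in `|0⟩`, implements an adjacency list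
oracle `|i, k⟩ ↦ |i, f(i, k)⟩` for `H` with sparsity parameter `s`. The second register has a flag
qubit and `N` further qubits; on input, the flag is `0` and the number `k < s` is in binary. -/
def ImplementsOF {N a : ℕ} (H : Matrix (Bits N) (Bits N) ℝ) (s : ℕ)
    (C : QCircuit ((Fin N ⊕ Fin 1 ⊕ Fin N) ⊕ Fin a)) : Prop :=
  ∃ f : Bits N → Fin s → Bool × Bits N, IsAdjacencyList H f ∧
    ∀ (i : Bits N) (k : Fin s),
      C.run (ketAnc a (Sum.elim i (Sum.elim (fun _ => false) (natBits N k)))) =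
        ketAnc a (Sum.elim i (Sum.elim (fun _ => (f i k).1) (f i k).2))

/-- The adjacency matrix oracle of `H` to `b` bits has a circuit with at most `g` gates on at most
`q` qubits (ancillas included). -/
def HasOH {N : ℕ} (H : Matrix (Bits N) (Bits N) ℝ) (b : ℕ) (g q : ℝ) : Prop :=
  ∃ (a : ℕ) (C : QCircuit ((Fin N ⊕ Fin N ⊕ Fin (b + 2)) ⊕ Fin a)),
    ImplementsOH H b C ∧ (C.length : ℝ) ≤ g ∧
      (Fintype.card ((Fin N ⊕ Fin N ⊕ Fin (b + 2)) ⊕ Fin a) : ℝ) ≤ q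

/-- The adjacency list oracle of `H` with sparsity parameter `s` has a circuit with at most `g`
gates on at most `q` qubits (ancillas included). -/
def HasOF {N : ℕ} (H : Matrix (Bits N) (Bits N) ℝ) (s : ℕ) (g q : ℝ) : Prop :=
  ∃ (a : ℕ) (C : QCircuit ((Fin N ⊕ Fin 1 ⊕ Fin N) ⊕ Fin a)),
    ImplementsOF H s C ∧ (C.length : ℝ) ≤ g ∧
      (Fintype.card ((Fin N ⊕ Fin 1 ⊕ Fin N) ⊕ Fin a) : ℝ) ≤ q

end

/-- The Kikuchi matrix of `I` has sparsity at most `C ℓ ln n`, and `I` has at most `C m`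
constraints. -/
def IsGood {n k : ℕ} (ℓ : ℕ) (m : ℝ≥0) (C : ℝ) (I : XORInstance n k) : Prop :=
  (∃ s : ℕ, (s : ℝ) ≤ C * (ℓ * Real.log n) ∧ IsSparse s (kikuchiMatrix ℓ I)) ∧
    (Multiset.card I : ℝ) ≤ C * m

end Kikuchi

/-! Sparsity. A nonzero entry in row T requires a constraint whose scope S satisfies |T ∆ S| = ℓ, so
the number of such constraints bounds the row. Signs play no role, hence neither do z and ρ. The
condition forces exactly k/2 elements of S into T, so a uniform S satisfies it with probability at
most k^k (ℓ/n)^(k/2) (`expect_matching_le`). The upper bound on m/n makes the mean count O(ℓ ln n),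
and an exponential Markov inequality for Poisson sums (`plantedPoisson_countP_tail`) yields a tail
n^(-3ℓ), which survives the union over at most n^ℓ rows. The same inequality and m ≥ a ℓ ln n
control the total number of constraints.

Oracles. Group the constraints by scope and drop the scopes of total weight zero; at most C m
remain. Each remaining S is a matching: T is joined to T ∆ S if that set has ℓ elements, and the
entry is the weight of S over Λ. On sorted lists, T ∆ S is obtained by toggling the k elements of S
one by one, a Boolean straight-line program with O(N) instructions for fixed k
(`HasProgram.neighbor`). Computing, copying and uncomputing makes it a reversible circuit with one
ancilla per instruction (`RevImpl.xorMap`), and a Toffoli gate splits into five two-qubit gates. The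
ancillas are reused from scope to scope, so O(N) qubits suffice for O(m N) gates.

The matrix oracle visits all scopes and adds the hard-wired rounded weight whenever S leads from i
to j; at most one scope does. The list oracle must replace its index in place. A first loop counts
the matched scopes, copies the neighbour of number k to a buffer and raises a flag. A second loop
runs backwards and clears the counter; at the scope whose neighbour is in the buffer the counter
equals k, so adding it to the index erases the index. Finally the buffer is moved to the index
register. If nothing was found, the index survives and the flag marks a dummy. No logarithmic factor
arises, so p = 0 works. -/

open scoped NNReal ENNReal symmDiff

namespace Kikuchi

/-! ## Classical reversible gates -/

/-- Classical reversible gates: negation, controlled negation and doubly controlled negation. -/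
inductive RevGate (W : Type) : Type
  | not (w : W) : RevGate W
  | cnot (u w : W) (h : u ≠ w) : RevGate W
  | toffoli (u v w : W) (huv : u ≠ v) (huw : u ≠ w) (hvw : v ≠ w) : RevGate W

/-- The permutation of bit strings that a reversible gate performs. -/
def RevGate.act {W : Type} [DecidableEq W] : RevGate W → (W → Bool) → (W → Bool)
  | .not w, x => Function.update x w (!(x w))
  | .cnot u w _, x => Function.update x w (xor (x w) (x u))
  | .toffoli u v w _ _ _, x => Function.update x w (xor (x w) (x u && x v))

theorem RevGate.act_act {W : Type} [DecidableEq W] (g : RevGate W) (x : W → Bool) :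
    g.act (g.act x) = x := by
  cases g with
  | not w => simp [RevGate.act]
  | cnot u w h => simp [RevGate.act, h]
  | toffoli u v w huv huw hvw => simp [RevGate.act, huw, hvw]

/-- The action of a list of reversible gates, applied from left to right. -/
def RevGate.actList {W : Type} [DecidableEq W] (l : List (RevGate W)) (x : W → Bool) : W → Bool :=
  l.foldl (fun y g => g.act y) x

theorem RevGate.actList_append {W : Type} [DecidableEq W] (l l' : List (RevGate W))
    (x : W → Bool) : actList (l ++ l') x = actList l' (actList l x) := by
  simp [actList]

theorem RevGate.actList_reverse {W : Type} [DecidableEq W] (l : List (RevGate W))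
    (x : W → Bool) : actList l.reverse (actList l x) = x := by
  induction l generalizing x with
  | nil => rfl
  | cons g l ih =>
    rw [List.reverse_cons, actList_append]
    have : actList (g :: l) x = actList l (g.act x) := rfl
    rw [this, ih]
    exact g.act_act x

/-- Relabelling of the wires of a gate. -/
def RevGate.relabel {W W' : Type} (e : W ≃ W') : RevGate W → RevGate W'
  | .not w => .not (e w)
  | .cnot u w h => .cnot (e u) (e w) (e.injective.ne h)
  | .toffoli u v w huv huw hvw => .toffoli (e u) (e v) (e w) (e.injective.ne huv)
      (e.injective.ne huw) (e.injective.ne hvw)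

theorem RevGate.act_relabel {W W' : Type} [DecidableEq W] [DecidableEq W'] (e : W ≃ W')
    (g : RevGate W) (x : W' → Bool) : (g.relabel e).act x ∘ e = g.act (x ∘ e) := by
  cases g <;> simp [RevGate.act, RevGate.relabel, Function.update_comp_equiv]

theorem RevGate.actList_relabel {W W' : Type} [DecidableEq W] [DecidableEq W'] (e : W ≃ W')
    (l : List (RevGate W)) (x : W' → Bool) :
    actList (l.map (RevGate.relabel e)) x ∘ e = actList l (x ∘ e) := by
  induction l generalizing x with
  | nil => rfl
  | cons g l ih =>
    have h1 : actList ((g :: l).map (RevGate.relabel e)) x =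
      actList (l.map (RevGate.relabel e)) ((g.relabel e).act x) := rfl
    have h2 : actList (g :: l) (x ∘ e) = actList l (g.act (x ∘ e)) := rfl
    rw [h1, h2, ih, act_relabel]

/-! ## Simulation of reversible gates by one- and two-qubit gates -/

section Simulation

variable {W : Type} [Fintype W] [DecidableEq W]

theorem QCircuit.run_append (C C' : QCircuit W) (ψ : (W → Bool) → ℂ) :
    QCircuit.run (C ++ C') ψ = QCircuit.run C' (QCircuit.run C ψ) := by
  simp [QCircuit.run]

/-- The state in which the qubit `w` is in the state `α` and the others are as in `x`. -/
noncomputable def qubitKet (x : W → Bool) (w : W) (α : Bool → ℂ) : (W → Bool) → ℂ :=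
  ∑ b, α b • ket (Function.update x w b)

theorem qubitKet_single (x : W → Bool) (w : W) (b : Bool) :
    qubitKet x w (Pi.single b 1) = ket (Function.update x w b) := by
  cases b <;> simp [qubitKet, Pi.single_apply]

theorem qubitKet_apply (x y : W → Bool) (w : W) (α : Bool → ℂ) :
    qubitKet x w α y = if ∀ u, u ≠ w → y u = x u then α (y w) else 0 := by
  have key : ∀ b, y = Function.update x w b ↔ (∀ u, u ≠ w → y u = x u) ∧ y w = b := by
    intro b
    rw [Function.eq_update_iff]
    tauto
  simp only [qubitKet, ket, Fintype.sum_bool, Pi.add_apply, Pi.smul_apply, Pi.single_apply, key,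
    smul_eq_mul]
  by_cases h : ∀ u, u ≠ w → y u = x u <;> cases hy : y w <;> simp [h]

/-- The negation, as a unitary matrix. -/
def notMatrix : Matrix Bool Bool ℂ := Matrix.of fun a b => if a = b then 0 else 1

/-- A square root of the negation. -/
noncomputable def sqrtNotMatrix : Matrix Bool Bool ℂ :=
  Matrix.of fun a b => if a = b then (1 + Complex.I) / 2 else (1 - Complex.I) / 2

theorem notMatrix_mem : notMatrix ∈ Matrix.unitaryGroup Bool ℂ := by
  rw [Matrix.mem_unitaryGroup_iff]
  ext a b
  cases a <;> cases b <;> simp [notMatrix, Matrix.mul_apply]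

theorem sqrtNotMatrix_mem : sqrtNotMatrix ∈ Matrix.unitaryGroup Bool ℂ := by
  rw [Matrix.mem_unitaryGroup_iff]
  ext a b
  cases a <;> cases b <;> simp [sqrtNotMatrix, Matrix.mul_apply] <;> ring_nf <;>
    simp [Complex.conj_ofNat] <;> norm_num

theorem sqrtNotMatrix_mul_self : sqrtNotMatrix * sqrtNotMatrix = notMatrix := by
  ext a b
  cases a <;> cases b <;> simp [sqrtNotMatrix, notMatrix, Matrix.mul_apply] <;> ring_nf <;>
    simp <;> norm_num

/-- The matrix on two qubits that applies `U` to the second if the first is `1`. -/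
def controlledMatrix (U : Matrix Bool Bool ℂ) : Matrix (Bool × Bool) (Bool × Bool) ℂ :=
  Matrix.of fun a b => if a.1 = b.1 then (if b.1 then U else 1) a.2 b.2 else 0

theorem controlledMatrix_mem {U : Matrix Bool Bool ℂ} (hU : U ∈ Matrix.unitaryGroup Bool ℂ) :
    controlledMatrix U ∈ Matrix.unitaryGroup (Bool × Bool) ℂ := by
  rw [Matrix.mem_unitaryGroup_iff] at hU ⊢
  ext ⟨a, b⟩ ⟨c, d⟩
  have h := congrFun (congrFun hU b) d
  simp only [Matrix.mul_apply, Fintype.sum_bool, Matrix.star_apply, RCLike.star_def] at h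
  cases a <;> cases c <;> simp [controlledMatrix, Matrix.mul_apply, Fintype.sum_prod_type]
  · cases b <;> cases d <;> simp
  · refine Eq.trans h ?_
    simp [Matrix.one_apply]

/-- The gate that applies `U` to `w` if `u` is `1`. -/
def controlledGate {u w : W} (h : u ≠ w) (U : Matrix.unitaryGroup Bool ℂ) : Gate W :=
  .two u w h ⟨controlledMatrix U, controlledMatrix_mem U.2⟩

theorem controlledGate_mulVec_ket {u w : W} (h : u ≠ w) (U : Matrix.unitaryGroup Bool ℂ)
    (x : W → Bool) :
    (controlledGate h U).matrix.mulVec (ket x) =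
      qubitKet x w fun b => (if x u then (U : Matrix Bool Bool ℂ) else 1) b (x w) := by
  funext y
  rw [qubitKet_apply, ket, Matrix.mulVec_single_one]
  simp only [Matrix.col_apply, controlledGate, Gate.matrix, Matrix.of_apply, controlledMatrix]
  by_cases hy : ∀ v, v ≠ w → y v = x v
  · rw [if_pos hy, if_pos fun v _ hv => hy v hv, if_pos (hy u h)]
  · rw [if_neg hy]
    by_cases h2 : y u = x u
    · rw [if_neg]
      refine fun h1 => hy fun v hv => ?_
      by_cases hvu : v = u
      · rw [hvu, h2]
      · exact h1 v hvu hv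
    · rw [if_neg h2, ite_self]

/-- While a Toffoli gate is being simulated, only its target leaves the computational basis. The
controls stay classical, so each intermediate gate reduces to a 2 × 2 matrix acting on α or to a
flip of a control. -/
theorem controlledGate_mulVec_qubitKet {u w : W} (h : u ≠ w) (U : Matrix.unitaryGroup Bool ℂ)
    (x : W → Bool) (α : Bool → ℂ) :
    (controlledGate h U).matrix.mulVec (qubitKet x w α) =
      qubitKet x w ((if x u then (U : Matrix Bool Bool ℂ) else 1).mulVec α) := by
  have h1 : (controlledGate h U).matrix.mulVec (qubitKet x w α) =
      ∑ b, α b • (controlledGate h U).matrix.mulVec (ket (Function.update x w b)) := by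
    simp only [qubitKet, Fintype.sum_bool, Matrix.mulVec_add, Matrix.mulVec_smul]
  rw [h1]
  funext y
  simp only [controlledGate_mulVec_ket, Fintype.sum_bool, Pi.add_apply, Pi.smul_apply,
    qubitKet_apply, Function.update_self, Function.update_of_ne h, smul_eq_mul, Matrix.mulVec,
    dotProduct]
  have hc : ∀ b, (∀ v, v ≠ w → y v = Function.update x w b v) ↔ ∀ v, v ≠ w → y v = x v :=
    fun b => forall₂_congr fun v hv => by rw [Function.update_of_ne hv]
  simp only [hc]
  split_ifs <;> ring

theorem cnot_mulVec_ket {u w : W} (h : u ≠ w) (x : W → Bool) :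
    (controlledGate h ⟨notMatrix, notMatrix_mem⟩).matrix.mulVec (ket x) =
      ket ((RevGate.cnot u w h).act x) := by
  rw [controlledGate_mulVec_ket, RevGate.act, ← qubitKet_single]
  congr 1
  funext b
  cases hu : x u <;> cases hw : x w <;> cases b <;> simp [notMatrix]

theorem cnot_mulVec_qubitKet {u v w : W} (h : u ≠ v) (huw : u ≠ w) (hvw : v ≠ w) (x : W → Bool)
    (α : Bool → ℂ) :
    (controlledGate h ⟨notMatrix, notMatrix_mem⟩).matrix.mulVec (qubitKet x w α) =
      qubitKet ((RevGate.cnot u v h).act x) w α := by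
  simp only [qubitKet, Fintype.sum_bool, Matrix.mulVec_add, Matrix.mulVec_smul, cnot_mulVec_ket,
    RevGate.act, Function.update_of_ne huw, Function.update_of_ne hvw,
    Function.update_comm hvw]

theorem not_mulVec_ket (w : W) (x : W → Bool) :
    (Gate.one w ⟨notMatrix, notMatrix_mem⟩).matrix.mulVec (ket x) =
      ket ((RevGate.not w).act x) := by
  rw [RevGate.act, ← qubitKet_single]
  funext y
  rw [qubitKet_apply, ket, Matrix.mulVec_single_one]
  simp only [Matrix.col_apply, Gate.matrix, Matrix.of_apply]
  split_ifs
  · cases x w <;> cases y w <;> simp [notMatrix]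
  · rfl

theorem exists_circuit_revGate (g : RevGate W) :
    ∃ C : QCircuit W, C.length ≤ 5 ∧ ∀ x, C.run (ket x) = ket (g.act x) := by
  cases g with
  | not w => exact ⟨[_], by simp, not_mulVec_ket w⟩
  | cnot u w h => exact ⟨[_], by simp, cnot_mulVec_ket h⟩
  | toffoli u v w huv huw hvw =>
    set R : Matrix.unitaryGroup Bool ℂ := ⟨sqrtNotMatrix, sqrtNotMatrix_mem⟩ 
    have hRR : (R : Matrix Bool Bool ℂ) * (R : Matrix Bool Bool ℂ) = notMatrix :=
      sqrtNotMatrix_mul_self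
    -- The target receives R to the power v - (u ⊕ v) + u = 2uv, and R² is the negation. The second
    -- controlled negation restores v.
    refine ⟨[controlledGate hvw R, controlledGate huv ⟨notMatrix, notMatrix_mem⟩,
      controlledGate hvw R⁻¹, controlledGate huv ⟨notMatrix, notMatrix_mem⟩,
      controlledGate huw R], by simp, fun x => ?_⟩
    have hx : ket x = qubitKet x w (Pi.single (x w) 1) := by
      rw [qubitKet_single, Function.update_eq_self]
    have hn : notMatrix.mulVec (Pi.single (x w) 1) = Pi.single (!(x w)) 1 := by
      funext b
      rw [Matrix.mulVec_single_one]
      cases x w <;> cases b <;> simp [notMatrix]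
    simp only [QCircuit.run, List.foldl_cons, List.foldl_nil]
    rw [hx, controlledGate_mulVec_qubitKet, cnot_mulVec_qubitKet huv huw hvw,
      controlledGate_mulVec_qubitKet, cnot_mulVec_qubitKet huv huw hvw,
      controlledGate_mulVec_qubitKet]
    have h1 : (RevGate.cnot u v huv).act ((RevGate.cnot u v huv).act x) = x :=
      RevGate.act_act _ _
    have h2 : (RevGate.cnot u v huv).act x v = xor (x v) (x u) := by
      simp [RevGate.act]
    rw [h1, h2, Matrix.mulVec_mulVec, Matrix.mulVec_mulVec]
    have h3 : (RevGate.toffoli u v w huv huw hvw).act x =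
      Function.update x w (xor (x w) (x u && x v)) := rfl
    rw [h3, ← qubitKet_single]
    generalize hα : (Pi.single (x w) (1 : ℂ) : Bool → ℂ) = α at hn ⊢
    cases x u <;> cases x v <;> simp [hRR, hn, hα]

theorem exists_circuit_actList (l : List (RevGate W)) :
    ∃ C : QCircuit W, C.length ≤ 5 * l.length ∧
      ∀ x, C.run (ket x) = ket (RevGate.actList l x) := by
  induction l with
  | nil => exact ⟨[], by simp, fun x => rfl⟩
  | cons g l ih =>
    obtain ⟨C, hC, hCx⟩ := ih
    obtain ⟨C', hC', hCx'⟩ := exists_circuit_revGate g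
    refine ⟨C' ++ C, ?_, fun x => ?_⟩
    · simp only [List.length_append, List.length_cons]
      omega
    · rw [QCircuit.run_append, hCx', hCx]
      rfl

end Simulation

/-! ## Straight-line programs -/

section Programs

variable {X : Type}

/-- Straight-line programs of conjunctions and negations over the base predicates `B`. The list
holds the computed predicates, the last one first. -/
inductive StraightLine (B : Set (X → Prop)) : List (X → Prop) → Prop
  | nil : StraightLine B []
  | const {L : List (X → Prop)} : StraightLine B L → StraightLine B ((fun _ => True) :: L)
  | not {L : List (X → Prop)} {u : X → Prop} : StraightLine B L → (u ∈ B ∨ u ∈ L) →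
      StraightLine B ((fun x => ¬u x) :: L)
  | and {L : List (X → Prop)} {u v : X → Prop} : StraightLine B L → (u ∈ B ∨ u ∈ L) →
      (v ∈ B ∨ v ∈ L) → StraightLine B ((fun x => u x ∧ v x) :: L)

theorem StraightLine.append {B B' : Set (X → Prop)} {L L' : List (X → Prop)}
    (hL : StraightLine B L) (hL' : StraightLine B' L') (hB : ∀ f ∈ B', f ∈ B ∨ f ∈ L) :
    StraightLine B (L' ++ L) := by
  have key : ∀ (M : List (X → Prop)) u, (u ∈ B' ∨ u ∈ M) → (u ∈ B ∨ u ∈ M ++ L) := by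
    intro M u hu
    rw [List.mem_append]
    rcases hu with hu | hu
    · rcases hB u hu with h | h <;> tauto
    · tauto
  induction hL' with
  | nil => exact hL
  | const _ ih => exact .const ih
  | not _ hu ih => exact .not ih (key _ _ hu)
  | and _ hu hv ih => exact .and ih (key _ _ hu) (key _ _ hv)

/-- All predicates in `F` can be computed from those in `B` by one straight-line program with at
most `g` instructions. -/
def HasProgram (B F : Set (X → Prop)) (g : ℕ) : Prop :=
  ∃ L, StraightLine B L ∧ L.length ≤ g ∧ ∀ f ∈ F, f ∈ B ∨ f ∈ L

variable {B B' F F' : Set (X → Prop)} {g g' : ℕ}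

theorem HasProgram.of_subset (h : F ⊆ B) : HasProgram B F 0 :=
  ⟨[], .nil, le_rfl, fun _ hf => .inl (h hf)⟩

theorem HasProgram.of_mem {u : X → Prop} (h : u ∈ B) : HasProgram B {u} 0 :=
  .of_subset (by simpa using h)

theorem HasProgram.mono (h : HasProgram B F g) (hB : B ⊆ B') (hF : F' ⊆ F) (hg : g ≤ g') :
    HasProgram B' F' g' := by
  obtain ⟨L, hL, hLg, hLF⟩ := h
  refine ⟨L, ?_, hLg.trans hg, fun f hf => (hLF f (hF hf)).imp (fun h => hB h) id⟩
  simpa using StraightLine.append (B := B') .nil hL fun f hf => .inl (hB hf)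

/-- Results of the first program become free base predicates of the second. Sharing intermediate
values in this way makes sizes add up, where formulas would multiply. -/
theorem HasProgram.trans (h : HasProgram B F g) (h' : HasProgram (B ∪ F) F' g') :
    HasProgram B (F ∪ F') (g + g') := by
  obtain ⟨L, hL, hLg, hLF⟩ := h
  obtain ⟨L', hL', hLg', hLF'⟩ := h'
  have hB : ∀ f ∈ B ∪ F, f ∈ B ∨ f ∈ L := by
    rintro f (hf | hf)
    · exact .inl hf
    · exact hLF f hf
  refine ⟨L' ++ L, hL.append hL' hB, by simp; omega, ?_⟩
  rintro f (hf | hf)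
  · rcases hLF f hf with h | h
    · exact .inl h
    · exact .inr (by simp [h])
  · rcases hLF' f hf with h | h
    · rcases hB f h with h | h
      · exact .inl h
      · exact .inr (by simp [h])
    · exact .inr (by simp [h])

theorem HasProgram.comp (h : HasProgram B F g) (h' : HasProgram (B ∪ F) F' g') :
    HasProgram B F' (g + g') :=
  (h.trans h').mono subset_rfl Set.subset_union_right le_rfl

theorem HasProgram.union (h : HasProgram B F g) (h' : HasProgram B F' g') :
    HasProgram B (F ∪ F') (g + g') :=
  h.trans (h'.mono Set.subset_union_left subset_rfl le_rfl)

theorem HasProgram.iUnion {m : ℕ} {F : ℕ → Set (X → Prop)}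
    (h : ∀ i < m, HasProgram B (F i) g) : HasProgram B {f | ∃ i < m, f ∈ F i} (m * g) := by
  induction m with
  | zero => exact ⟨[], .nil, by simp, by rintro f ⟨i, hi, -⟩; omega⟩
  | succ m ih =>
    refine ((ih fun i hi => h i (by omega)).union (h m (by omega))).mono subset_rfl ?_
      (by rw [Nat.succ_mul])
    rintro f ⟨i, hi, hf⟩
    rcases Nat.lt_succ_iff_lt_or_eq.1 hi with hi | rfl
    · exact .inl ⟨i, hi, hf⟩
    · exact .inr hf

theorem HasProgram.const_true : HasProgram B {fun _ => True} 1 :=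
  ⟨_, .const .nil, by simp, by simp⟩

theorem HasProgram.not {u : X → Prop} (h : HasProgram B {u} g) :
    HasProgram B {fun x => ¬u x} (g + 1) :=
  h.comp ⟨_, .not .nil (u := u) (by simp), by simp, by simp⟩

theorem HasProgram.and {u v : X → Prop} (h : HasProgram B {u} g) (h' : HasProgram B {v} g') :
    HasProgram B {fun x => u x ∧ v x} (g + g' + 1) :=
  (h.union h').comp ⟨_, .and .nil (u := u) (v := v) (by simp) (by simp), by simp, by simp⟩

theorem HasProgram.const_false : HasProgram B {fun _ => False} 2 := by
  simpa using (HasProgram.const_true (B := B)).not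

theorem HasProgram.or {u v : X → Prop} (h : HasProgram B {u} g) (h' : HasProgram B {v} g') :
    HasProgram B {fun x => u x ∨ v x} (g + g' + 4) := by
  refine (h.not.and h'.not).not.mono subset_rfl ?_ (by omega)
  rw [Set.singleton_subset_iff, Set.mem_singleton_iff]
  funext x
  simp only [eq_iff_iff]
  tauto

theorem HasProgram.iff {u v : X → Prop} (h : HasProgram B {u} g) (h' : HasProgram B {v} g') :
    HasProgram B {fun x => u x ↔ v x} (2 * g + 2 * g' + 7) := by
  refine ((h.and h'.not).not.and (h.not.and h').not).mono subset_rfl ?_ (by omega)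
  rw [Set.singleton_subset_iff, Set.mem_singleton_iff]
  funext x
  simp only [eq_iff_iff]
  tauto

theorem HasProgram.ite {c u v : X → Prop} (hc : HasProgram B {c} 0) (h : HasProgram B {u} g)
    (h' : HasProgram B {v} g') :
    HasProgram B {fun x => (c x ∧ u x) ∨ (¬c x ∧ v x)} (g + g' + 7) :=
  ((hc.and h).or (hc.not.and h')).mono subset_rfl subset_rfl (by omega)

/-- Each prefix conjunction is one `and` away from the preceding one, so all of them together cost
only m further instructions. Besides bounded quantifiers, this yields the carry bits of a counter.
-/
theorem HasProgram.initial {m : ℕ} {c : X → Prop} {u : ℕ → X → Prop} (hc : HasProgram B {c} g)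
    (h : ∀ i < m, u i ∈ B) :
    HasProgram B {f | ∃ i ≤ m, f = fun x => c x ∧ ∀ j < i, u j x} (g + m) := by
  induction m with
  | zero => exact hc.mono subset_rfl (by rintro f ⟨i, hi, rfl⟩; simp [Nat.le_zero.1 hi]) (by simp)
  | succ m ih =>
    refine ((ih fun i hi => h i (by omega)).trans (F' := {fun x => (c x ∧ ∀ j < m, u j x) ∧ u m x})
      (g' := 1) ?_).mono subset_rfl ?_ (by omega)
    · exact (HasProgram.of_mem (.inr ⟨m, le_rfl, rfl⟩)).and
        (HasProgram.of_mem (.inl (h m (by omega))))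
    · rintro f ⟨i, hi, rfl⟩
      rcases Nat.le_succ_iff.1 hi with hi | rfl
      · exact .inl ⟨i, hi, rfl⟩
      · refine .inr ?_
        rw [Set.mem_singleton_iff]
        funext x
        simp only [eq_iff_iff, Nat.lt_succ_iff_lt_or_eq, and_assoc]
        refine and_congr_right fun _ => ⟨fun h => ⟨fun j hj => h j (.inl hj), h m (.inr rfl)⟩, ?_⟩
        rintro ⟨h1, h2⟩ j (hj | rfl)
        · exact h1 j hj
        · exact h2

theorem HasProgram.forall {m : ℕ} {u : ℕ → X → Prop} (h : ∀ i < m, HasProgram B {u i} g) :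
    HasProgram B {fun x => ∀ i < m, u i x} (m * g + m + 1) := by
  refine ((HasProgram.iUnion h).comp
    (HasProgram.initial (m := m) (u := u) HasProgram.const_true fun i hi => .inr ⟨i, hi, rfl⟩)).mono
    subset_rfl ?_ (by omega)
  rw [Set.singleton_subset_iff]
  exact ⟨m, le_rfl, by simp⟩

theorem HasProgram.exists {m : ℕ} {u : ℕ → X → Prop} (h : ∀ i < m, HasProgram B {u i} g) :
    HasProgram B {fun x => ∃ i < m, u i x} (m * (g + 1) + m + 2) := by
  refine (HasProgram.forall fun i hi => (h i hi).not).not.mono subset_rfl ?_ (by omega)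
  rw [Set.singleton_subset_iff, Set.mem_singleton_iff]
  funext x
  simp

theorem HasProgram.iUnion_fin {m : ℕ} {F : Fin m → X → Prop}
    (h : ∀ p, HasProgram B {F p} g) : HasProgram B {f | ∃ p, f = F p} (m * g) := by
  refine (HasProgram.iUnion (m := m) (F := fun i => {f | ∃ h : i < m, f = F ⟨i, h⟩})
    fun i hi => (h ⟨i, hi⟩).mono subset_rfl ?_ le_rfl).mono subset_rfl ?_ le_rfl
  · rintro f ⟨_, rfl⟩
    rfl
  · rintro f ⟨p, rfl⟩
    exact ⟨p, p.2, p.2, rfl⟩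

theorem HasProgram.initial_fin {m : ℕ} {c : X → Prop} {u : Fin m → X → Prop}
    (hc : HasProgram B {c} g) (h : ∀ i, u i ∈ B) :
    HasProgram B {f | ∃ i, f = fun x => c x ∧ ∀ j < i, u j x} (g + m) := by
  refine (HasProgram.initial (u := fun i x => ∀ h : i < m, u ⟨i, h⟩ x) hc ?_).mono subset_rfl ?_
    le_rfl
  · intro i hi
    simp only [hi, forall_true_left]
    exact h _
  · rintro f ⟨i, rfl⟩
    refine ⟨i, i.2.le, ?_⟩
    funext x
    simp only [eq_iff_iff]
    refine and_congr_right fun _ => ⟨fun h j hj hjm => h ⟨j, hjm⟩ hj, fun h j hj => h j hj j.2⟩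

theorem HasProgram.forall_fin {m : ℕ} {u : Fin m → X → Prop} (h : ∀ i, HasProgram B {u i} g) :
    HasProgram B {fun x => ∀ i, u i x} (m * g + m + 1) := by
  refine (HasProgram.forall (m := m) (u := fun i x => ∀ h : i < m, u ⟨i, h⟩ x) ?_).mono subset_rfl
    ?_ le_rfl
  · intro i hi
    simp only [hi, forall_true_left]
    exact h _
  · rw [Set.singleton_subset_iff, Set.mem_singleton_iff]
    funext x
    simp only [eq_iff_iff]
    exact ⟨fun h i hi _ => h ⟨i, hi⟩, fun h i => h i i.2 i.2⟩

theorem HasProgram.eq_bits {m : ℕ} {u v : X → Bits m}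
    (hu : ∀ q, HasProgram B {fun x => u x q = Bool.true} 0)
    (hv : ∀ q, HasProgram B {fun x => v x q = Bool.true} 0) :
    HasProgram B {fun x => u x = v x} (8 * m + 1) := by
  refine (HasProgram.forall_fin fun q => (hu q).iff (hv q)).mono subset_rfl ?_ (by omega)
  rw [Set.singleton_subset_iff, Set.mem_singleton_iff]
  funext x
  rw [eq_iff_iff, funext_iff]
  exact forall_congr' fun q => Bool.eq_iff_iff

/-- The leading bits decide unless they agree, and then the lower bits do. Reduction modulo 2^w lets
the width vary in the induction while u and v stay fixed. -/
theorem HasProgram.lt_mod {w : ℕ} {u v : X → ℕ}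
    (hu : ∀ p < w, HasProgram B {fun x => (u x).testBit p = true} 0)
    (hv : ∀ p < w, HasProgram B {fun x => (v x).testBit p = true} 0) :
    HasProgram B {fun x => u x % 2 ^ w < v x % 2 ^ w} (14 * w + 2) := by
  induction w with
  | zero => simpa [Nat.mod_one] using HasProgram.const_false (B := B)
  | succ w ih =>
    have ih' := ih (fun p hp => hu p (by omega)) fun p hp => hv p (by omega)
    refine (((hu w (by omega)).not.and (hv w (by omega))).or
      (((hu w (by omega)).iff (hv w (by omega))).and ih')).mono subset_rfl ?_ (by omega)
    rw [Set.singleton_subset_iff, Set.mem_singleton_iff]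
    funext x
    simp only [eq_iff_iff, Nat.mod_pow_succ, Nat.testBit_eq_decide_div_mod_eq, decide_eq_true_eq]
    have h1 := Nat.mod_lt (u x) (Nat.two_pow_pos w)
    have h2 := Nat.mod_lt (v x) (Nat.two_pow_pos w)
    rcases Nat.mod_two_eq_zero_or_one (u x / 2 ^ w) with h3 | h3 <;>
      rcases Nat.mod_two_eq_zero_or_one (v x / 2 ^ w) with h4 | h4 <;> simp [h3, h4] <;> omega

theorem HasProgram.lt {w : ℕ} {u v : X → ℕ}
    (hu : ∀ p < w, HasProgram B {fun x => (u x).testBit p = true} 0)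
    (hv : ∀ p < w, HasProgram B {fun x => (v x).testBit p = true} 0)
    (hu' : ∀ x, u x < 2 ^ w) (hv' : ∀ x, v x < 2 ^ w) :
    HasProgram B {fun x => u x < v x} (14 * w + 2) := by
  have h := HasProgram.lt_mod hu hv
  simpa only [Nat.mod_eq_of_lt (hu' _), Nat.mod_eq_of_lt (hv' _)] using h

theorem HasProgram.eq {w : ℕ} {u v : X → ℕ}
    (hu : ∀ p < w, HasProgram B {fun x => (u x).testBit p = true} 0)
    (hv : ∀ p < w, HasProgram B {fun x => (v x).testBit p = true} 0)
    (hu' : ∀ x, u x < 2 ^ w) (hv' : ∀ x, v x < 2 ^ w) :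
    HasProgram B {fun x => u x = v x} (28 * w + 7) := by
  refine ((HasProgram.lt hu hv hu' hv').not.and (HasProgram.lt hv hu hv' hu').not).mono
    subset_rfl ?_ (by omega)
  rw [Set.singleton_subset_iff, Set.mem_singleton_iff]
  funext x
  simp only [eq_iff_iff]
  omega

end Programs

/-! ## Reversible evaluation of straight-line programs -/

section Reversible

open Classical in
/-- The contents of the ancillas after the program `L` has been run on `x`. -/
noncomputable def ancillaBits {X : Type} {a : ℕ} (L : List (X → Prop)) (x : X) : Fin a → Bool :=
  -- Programs hold their newest predicate first; after reversal, instruction i owns ancilla i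
  -- whatever is appended later. The default `False` is the initial value of an ancilla not yet
  -- written.
  fun i => decide (L.reverse.getD i (fun _ => False) x)

theorem ancillaBits_nil {X : Type} {a : ℕ} (x : X) :
    (ancillaBits [] x : Fin a → Bool) = fun _ => false := by
  funext i
  simp [ancillaBits]

open Classical in
theorem ancillaBits_cons {X : Type} {a : ℕ} (f : X → Prop) (L : List (X → Prop))
    (h : L.length < a) (x : X) :
    (ancillaBits (f :: L) x : Fin a → Bool) =
      Function.update (ancillaBits L x) ⟨L.length, h⟩ (decide (f x)) := by
  funext i
  by_cases hi : i = ⟨L.length, h⟩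
  · subst hi
    simp [ancillaBits]
  · have hi' : (i : ℕ) ≠ L.length := fun h => hi (Fin.ext h)
    rw [Function.update_of_ne hi]
    simp only [ancillaBits, List.reverse_cons]
    rcases lt_or_gt_of_ne hi' with h' | h'
    · rw [List.getD_append _ _ _ _ (by simpa using h')]
    · rw [List.getD_eq_default _ _ (by simp; omega), List.getD_eq_default _ _ (by simp; omega)]

theorem ancillaBits_self {X : Type} {a : ℕ} (L : List (X → Prop)) (h : L.length < a) (x : X) :
    (ancillaBits L x : Fin a → Bool) ⟨L.length, h⟩ = false := by
  simp [ancillaBits]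

variable {V : Type}

/-- The predicates that read one bit of the register outside `T`. -/
def bitsOff (T : Finset V) : Set ((V → Bool) → Prop) :=
  {f | ∃ v ∉ T, f = fun x => x v = true}

open Classical in
-- Every value an instruction may read sits on a wire that is neither a target in T nor the next
-- free ancilla, hence is a legal control. The register y may differ from x on T because the targets
-- are overwritten one at a time while the ancillas still hold the values for x.
theorem exists_wire {a : ℕ} {T : Finset V} {L : List ((V → Bool) → Prop)} (ha : L.length ≤ a)
    {u : (V → Bool) → Prop} (hu : u ∈ bitsOff T ∨ u ∈ L) :
    ∃ w : V ⊕ Fin a, (∀ v ∈ T, w ≠ .inl v) ∧ (∀ h : L.length < a, w ≠ .inr ⟨L.length, h⟩) ∧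
      ∀ x y : V → Bool, (∀ v ∉ T, y v = x v) →
        Sum.elim y (ancillaBits L x) w = decide (u x) := by
  rcases hu with ⟨v, hv, rfl⟩ | hu
  · refine ⟨.inl v, ?_, by simp, fun x y h => by simp [h v hv]⟩
    rintro v' hv' h
    cases h
    exact hv hv'
  · obtain ⟨i, hi, rfl⟩ := List.mem_iff_getElem.1 (List.mem_reverse.2 hu)
    have hi' : i < L.length := by simpa using hi
    refine ⟨.inr ⟨i, by omega⟩, by simp, fun h => by simp; omega, fun x y _ => ?_⟩
    simp [ancillaBits, hi']

/-- A program that never reads T cannot notice that T has changed. This is what allows uncomputation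
after the targets have been overwritten. -/
theorem StraightLine.congr_of_mem {T : Finset V} {L : List ((V → Bool) → Prop)}
    (hL : StraightLine (bitsOff T) L) {x y : V → Bool} (h : ∀ v ∉ T, y v = x v)
    {f : (V → Bool) → Prop} (hf : f ∈ bitsOff T ∨ f ∈ L) : f y ↔ f x := by
  have hB : ∀ f ∈ bitsOff T, (f y ↔ f x) := by
    rintro f ⟨v, hv, rfl⟩
    simp only [h v hv]
  have hLs : ∀ f ∈ L, (f y ↔ f x) := by
    clear hf
    induction hL with
    | nil => simp
    | const _ ih => simpa using ih
    | not _ hu ih =>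
      have hu' := hu.elim (hB _) (ih _)
      intro f hf
      rcases List.mem_cons.1 hf with rfl | hf
      · simp only [hu']
      · exact ih f hf
    | and _ hu hv ih =>
      have hu' := hu.elim (hB _) (ih _)
      have hv' := hv.elim (hB _) (ih _)
      intro f hf
      rcases List.mem_cons.1 hf with rfl | hf
      · simp only [hu', hv']
      · exact ih f hf
  exact hf.elim (hB f) (hLs f)

theorem StraightLine.ancillaBits_congr {a : ℕ} {T : Finset V} {L : List ((V → Bool) → Prop)}
    (hL : StraightLine (bitsOff T) L) {x y : V → Bool} (h : ∀ v ∉ T, y v = x v) :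
    (ancillaBits L y : Fin a → Bool) = ancillaBits L x := by
  funext i
  simp only [ancillaBits, decide_eq_decide]
  by_cases hi : (i : ℕ) < L.reverse.length
  · rw [List.getD_eq_getElem _ _ hi]
    exact hL.congr_of_mem h (.inr (List.mem_reverse.1 (List.getElem_mem hi)))
  · rw [List.getD_eq_default _ _ (by omega)]

variable [DecidableEq V]

theorem StraightLine.exists_revGates {a : ℕ} {T : Finset V} {L : List ((V → Bool) → Prop)}
    (hL : StraightLine (bitsOff T) L) (ha : L.length ≤ a) :
    ∃ l : List (RevGate (V ⊕ Fin a)), l.length ≤ 2 * L.length ∧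
      ∀ x, RevGate.actList l (Sum.elim x fun _ => false) = Sum.elim x (ancillaBits L x) := by
  classical
  have step : ∀ {f : (V → Bool) → Prop} {L : List ((V → Bool) → Prop)}
      (h : L.length < a) (l : List (RevGate (V ⊕ Fin a))), l.length ≤ 2 →
      (∀ x, RevGate.actList l (Sum.elim x (ancillaBits L x)) =
        Function.update (Sum.elim x (ancillaBits L x)) (.inr ⟨L.length, h⟩) (decide (f x))) →
      (∃ l : List (RevGate (V ⊕ Fin a)), l.length ≤ 2 * L.length ∧
        ∀ x, RevGate.actList l (Sum.elim x fun _ => false) = Sum.elim x (ancillaBits L x)) →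
      ∃ l : List (RevGate (V ⊕ Fin a)), l.length ≤ 2 * (f :: L).length ∧
        ∀ x, RevGate.actList l (Sum.elim x fun _ => false) =
          Sum.elim x (ancillaBits (f :: L) x) := by
    rintro f L h l hl hlx ⟨l', hl', hlx'⟩
    refine ⟨l' ++ l, by simp; omega, fun x => ?_⟩
    rw [RevGate.actList_append, hlx', hlx, ancillaBits_cons _ _ h, Sum.update_elim_inr]
  induction hL with
  | nil => exact ⟨[], by simp, fun x => by simp [ancillaBits_nil, RevGate.actList]⟩
  | @const L _ ih =>
    simp only [List.length_cons] at ha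
    refine step (by omega) [.not (.inr ⟨L.length, by omega⟩)] (by simp) (fun x => ?_)
      (ih (by omega))
    simp only [RevGate.actList, RevGate.act, List.foldl_cons, List.foldl_nil, Sum.elim_inr,
      ancillaBits_self]
    congr 1
    simp
  | @not L u _ hu ih =>
    simp only [List.length_cons] at ha
    obtain ⟨w, -, hw, hwx⟩ := exists_wire (by omega : L.length ≤ a) hu
    refine step (by omega) [.cnot w (.inr ⟨L.length, by omega⟩) (hw _),
      .not (.inr ⟨L.length, by omega⟩)] (by simp) (fun x => ?_) (ih (by omega))
    simp only [RevGate.actList, RevGate.act, List.foldl_cons, List.foldl_nil, Sum.elim_inr,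
      ancillaBits_self, hwx x x fun _ _ => rfl, Function.update_self, Function.update_idem]
    congr 1
    simp
  | @and L u v _ hu hv ih =>
    simp only [List.length_cons] at ha
    obtain ⟨w, -, hw, hwx⟩ := exists_wire (by omega : L.length ≤ a) hu
    obtain ⟨w', -, hw', hwx'⟩ := exists_wire (by omega : L.length ≤ a) hv
    -- Both operands may sit on the same wire, where a Toffoli gate is not available; the
    -- conjunction is then a plain copy.
    by_cases hww : w = w'
    · subst hww
      refine step (by omega) [.cnot w (.inr ⟨L.length, by omega⟩) (hw _)] (by simp) (fun x => ?_)
        (ih (by omega))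
      have h1 := hwx x x fun _ _ => rfl
      have h2 := hwx' x x fun _ _ => rfl
      rw [h1, decide_eq_decide] at h2
      simp only [RevGate.actList, RevGate.act, List.foldl_cons, List.foldl_nil, Sum.elim_inr,
        ancillaBits_self, h1]
      congr 1
      simp [h2]
    · refine step (by omega) [.toffoli w w' (.inr ⟨L.length, by omega⟩) hww (hw _) (hw' _)]
        (by simp) (fun x => ?_) (ih (by omega))
      simp only [RevGate.actList, RevGate.act, List.foldl_cons, List.foldl_nil, Sum.elim_inr,
        ancillaBits_self, hwx x x fun _ _ => rfl, hwx' x x fun _ _ => rfl]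
      congr 1
      simp

open Classical in
/-- The map that adds the bits `F v x` to the bits `v ∈ T` of `x`. -/
noncomputable def xorMap (T : Finset V) (F : V → (V → Bool) → Prop) (x : V → Bool) : V → Bool :=
  fun v => if v ∈ T then xor (x v) (decide (F v x)) else x v

theorem xorMap_empty (F : V → (V → Bool) → Prop) (x : V → Bool) : xorMap ∅ F x = x := by
  funext v
  simp [xorMap]

/-- The map `π` on a register is performed by `g` reversible gates with `a` ancillas that start
and end in `0`. -/
def RevImpl (a g : ℕ) (π : (V → Bool) → (V → Bool)) : Prop :=
  ∃ l : List (RevGate (V ⊕ Fin a)), l.length ≤ g ∧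
    ∀ x, RevGate.actList l (Sum.elim x fun _ => false) = Sum.elim (π x) fun _ => false

theorem RevImpl.id {a : ℕ} : RevImpl a 0 (id : (V → Bool) → (V → Bool)) :=
  ⟨[], le_rfl, fun _ => rfl⟩

theorem RevImpl.comp {a g g' : ℕ} {π π' : (V → Bool) → (V → Bool)} (h' : RevImpl a g' π')
    (h : RevImpl a g π) : RevImpl a (g + g') (π' ∘ π) := by
  obtain ⟨l, hl, hlx⟩ := h
  obtain ⟨l', hl', hlx'⟩ := h'
  refine ⟨l ++ l', by simp; omega, fun x => ?_⟩
  rw [RevGate.actList_append, hlx, hlx']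
  rfl

theorem RevImpl.mono {a g g' : ℕ} {π : (V → Bool) → (V → Bool)} (h : RevImpl a g π)
    (hg : g ≤ g') : RevImpl a g' π := by
  obtain ⟨l, hl, hlx⟩ := h
  exact ⟨l, hl.trans hg, hlx⟩

theorem RevImpl.foldl {ι : Type} {a g : ℕ} {π : ι → (V → Bool) → (V → Bool)} (L : List ι)
    (h : ∀ i ∈ L, RevImpl a g (π i)) :
    RevImpl a (L.length * g) fun x => L.foldl (fun y i => π i y) x := by
  induction L with
  | nil => exact RevImpl.id.mono (by simp)
  | cons i L ih =>
    exact ((ih fun j hj => h j (by simp [hj])).comp (h i (by simp))).mono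
      (by rw [List.length_cons, Nat.succ_mul, add_comm])

/-- Compute, copy, uncompute: at most 2g gates fill the ancillas, one controlled negation per target
copies the results, and the first gates in reverse order clear the ancillas. -/
theorem RevImpl.xorMap {a g : ℕ} {T : Finset V} {F : V → (V → Bool) → Prop}
    (h : HasProgram (bitsOff T) {f | ∃ v ∈ T, f = F v} g) (hg : g ≤ a) :
    RevImpl a (4 * g + T.card) (xorMap T F) := by
  classical
  obtain ⟨L, hL, hLg, hLF⟩ := h
  obtain ⟨l, hl, hlx⟩ := hL.exists_revGates (hLg.trans hg)
  have key : ∀ T' ⊆ T, ∃ l' : List (RevGate (V ⊕ Fin a)), l'.length ≤ T'.card ∧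
      ∀ x, RevGate.actList l' (Sum.elim x (ancillaBits L x)) =
        Sum.elim (Kikuchi.xorMap T' F x) (ancillaBits L x) := by
    intro T'
    induction T' using Finset.induction_on with
    | empty => exact fun _ => ⟨[], by simp, fun x => by simp [RevGate.actList, Kikuchi.xorMap_empty]⟩
    | insert v T' hv ih =>
      intro hT'
      obtain ⟨l', hl', hlx'⟩ := ih ((Finset.subset_insert _ _).trans hT')
      have hvT : v ∈ T := hT' (Finset.mem_insert_self _ _)
      obtain ⟨w, hw, -, hwx⟩ := exists_wire (hLg.trans hg) (hLF _ ⟨v, hvT, rfl⟩)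
      refine ⟨l' ++ [.cnot w (.inl v) (hw v hvT)], by simp [hv, hl'], fun x => ?_⟩
      rw [RevGate.actList_append, hlx']
      have h1 : Sum.elim (Kikuchi.xorMap T' F x) (ancillaBits L x) w = decide (F v x) :=
        hwx x _ fun u hu => by
          rw [Kikuchi.xorMap, if_neg fun hu' => hu (hT' (Finset.mem_insert_of_mem hu'))]
      simp only [RevGate.actList, RevGate.act, List.foldl_cons, List.foldl_nil, h1,
        Sum.update_elim_inl, Sum.elim_inl]
      congr 1
      funext u
      by_cases hu : u = v
      · subst hu
        simp [Kikuchi.xorMap, hv]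
      · simp [Kikuchi.xorMap, hu]
  obtain ⟨l', hl', hlx'⟩ := key T subset_rfl
  refine ⟨l ++ l' ++ l.reverse, by simp; omega, fun x => ?_⟩
  -- The ancillas are exactly those that the program would produce from the updated register, so its
  -- reversal clears them.
  have h1 : (ancillaBits L x : Fin a → Bool) = ancillaBits L (Kikuchi.xorMap T F x) :=
    (hL.ancillaBits_congr fun v hv => by rw [Kikuchi.xorMap, if_neg hv]).symm
  rw [RevGate.actList_append, RevGate.actList_append, hlx, hlx', h1, ← hlx,
    RevGate.actList_reverse]

theorem RevImpl.exists_circuit [Fintype V] {a g : ℕ} {π : (V → Bool) → (V → Bool)}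
    (h : RevImpl a g π) :
    ∃ C : QCircuit (V ⊕ Fin a), C.length ≤ 5 * g ∧
      ∀ x, C.run (ketAnc a x) = ketAnc a (π x) := by
  obtain ⟨l, hl, hlx⟩ := h
  obtain ⟨C, hC, hCx⟩ := exists_circuit_actList l
  refine ⟨C, by omega, fun x => ?_⟩
  rw [ketAnc, ketAnc, hCx, hlx]

/-- Named work registers A that are zero at both ends become anonymous ancillas after relabelling.
Only the behaviour of π on zero work registers matters. -/
theorem RevImpl.exists_circuit_ancillas {A : Type} [Fintype V] [Fintype A] [DecidableEq A]
    {a g : ℕ} {π : (V ⊕ A → Bool) → (V ⊕ A → Bool)} (h : RevImpl a g π) :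
    ∃ C : QCircuit (V ⊕ Fin (Fintype.card A + a)), C.length ≤ 5 * g ∧
      ∀ x y, π (Sum.elim x fun _ => false) = Sum.elim y (fun _ => false) →
        C.run (ketAnc (Fintype.card A + a) x) = ketAnc (Fintype.card A + a) y := by
  obtain ⟨l, hl, hlx⟩ := h
  let e : (V ⊕ A) ⊕ Fin a ≃ V ⊕ Fin (Fintype.card A + a) :=
    (Equiv.sumAssoc V A (Fin a)).trans ((Equiv.refl V).sumCongr
      (((Fintype.equivFin A).sumCongr (Equiv.refl _)).trans finSumFinEquiv))
  obtain ⟨C, hC, hCx⟩ := exists_circuit_actList (l.map (RevGate.relabel e))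
  have he : ∀ x : V → Bool,
      (Sum.elim x fun _ => false : V ⊕ Fin (Fintype.card A + a) → Bool) ∘ e =
        Sum.elim (Sum.elim x fun _ => false) fun _ => false := by
    intro x
    funext v
    rcases v with (v | v) | v <;> simp [e]
  refine ⟨C, by simp at hC; omega, fun x y hxy => ?_⟩
  rw [ketAnc, ketAnc, hCx]
  congr 1
  apply e.surjective.injective_comp_right
  change RevGate.actList _ _ ∘ e = _ ∘ e
  rw [RevGate.actList_relabel, he, he, hlx, hxy]

open Classical in
/-- The map that adds the bits `F p x` to the bits `w p` of `x`. -/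
noncomputable def xorInto {m : ℕ} (w : Fin m → V) (F : Fin m → (V → Bool) → Prop) (x : V → Bool) :
    V → Bool :=
  fun v => xor (x v) (decide (∃ p, w p = v ∧ F p x))

theorem RevImpl.xorInto {a g m : ℕ} {w : Fin m → V} (hw : Function.Injective w)
    {F : Fin m → (V → Bool) → Prop}
    (h : HasProgram {f | ∃ v, (∀ p, w p ≠ v) ∧ f = fun x => x v = true} {f | ∃ p, f = F p} g)
    (hg : g ≤ a) : RevImpl a (4 * g + m) (xorInto w F) := by
  classical
  have hT : (Finset.univ.image w).card = m := by
    rw [Finset.card_image_of_injective _ hw, Finset.card_univ, Fintype.card_fin]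
  have hF : ∀ p, (fun x => ∃ p', w p' = w p ∧ F p' x) = F p := by
    intro p
    funext x
    simp [hw.eq_iff]
  have h1 := RevImpl.xorMap (T := Finset.univ.image w) (F := fun v x => ∃ p, w p = v ∧ F p x)
    (h.mono ?_ ?_ le_rfl) hg
  · rw [hT] at h1
    convert h1 using 1
    funext x v
    rw [Kikuchi.xorMap, Kikuchi.xorInto]
    split_ifs with hv
    · congr
    · have : ¬∃ p, w p = v ∧ F p x := by
        rintro ⟨p, rfl, -⟩
        exact hv (by simp)
      simp [this]
  · rintro f ⟨v, hv, rfl⟩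
    exact ⟨v, by simpa using hv, rfl⟩
  · rintro f ⟨v, hv, rfl⟩
    obtain ⟨p, -, rfl⟩ := Finset.mem_image.1 hv
    exact ⟨p, hF p⟩

end Reversible

/-! ## Toggling the elements of a sorted list -/

open Classical in
/-- Insert `s` into the sorted sequence `t` if it does not occur there, and delete it otherwise. -/
noncomputable def toggle (s : ℕ) (t : ℕ → ℕ) (j : ℕ) : ℕ :=
  if t j < s then t j
  else if ∃ i, t i = s then t (j + 1)
  -- The new element goes to the first position whose entry is not below s. Position 0 is listed
  -- apart because `0 - 1 = 0`.
  else if j = 0 ∨ t (j - 1) < s then s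
  else t (j - 1)

/-- Toggle all elements of `l`. -/
noncomputable def toggleList (l : List ℕ) (t : ℕ → ℕ) : ℕ → ℕ :=
  l.foldl (fun t s => toggle s t) t

theorem toggle_le {D s : ℕ} {t : ℕ → ℕ} (hs : s ≤ D) (ht : ∀ j, t j ≤ D) (j : ℕ) :
    toggle s t j ≤ D := by
  unfold toggle
  split_ifs
  exacts [ht _, ht _, hs, ht _]

theorem toggle_eq {D s L : ℕ} {t : ℕ → ℕ} (hs : s ≤ D) (ht : ∀ j ≥ L, t j = D) (j : ℕ)
    (hj : L + 1 ≤ j) : toggle s t j = D := by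
  unfold toggle
  rw [ht j (by omega), ht (j + 1) (by omega), ht (j - 1) (by omega), if_neg (by omega)]
  simp [show ¬D < s by omega, show j ≠ 0 by omega]

theorem toggleList_le {D : ℕ} {l : List ℕ} (hl : ∀ s ∈ l, s ≤ D) {t : ℕ → ℕ}
    (ht : ∀ j, t j ≤ D) (j : ℕ) : toggleList l t j ≤ D := by
  induction l generalizing t with
  | nil => exact ht j
  | cons s l ih =>
    exact ih (fun s' hs' => hl s' (by simp [hs'])) (toggle_le (hl s (by simp)) ht)

/-- The sequence `t` lists the elements of `T` that are below `D` in increasing order, and is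
equal to `D` from then on. -/
def Enumerates (D : ℕ) (t : ℕ → ℕ) (T : Finset ℕ) : Prop :=
  ∀ j, t j ≤ D ∧ ∀ x ≤ D, (t j < x ↔ j < (T.filter (· < x)).card)

theorem card_filter_lt_mono (T : Finset ℕ) {x y : ℕ} (h : x ≤ y) :
    (T.filter (· < x)).card ≤ (T.filter (· < y)).card :=
  Finset.card_le_card fun z hz => by
    simp only [Finset.mem_filter] at hz ⊢
    exact ⟨hz.1, by omega⟩

theorem card_filter_lt_succ (T : Finset ℕ) (s : ℕ) :
    (T.filter (· < s + 1)).card = (T.filter (· < s)).card + if s ∈ T then 1 else 0 := by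
  have h : T.filter (· < s + 1) = T.filter (· < s) ∪ T.filter (· = s) := by
    ext x
    simp only [Finset.mem_filter, Finset.mem_union]
    rw [← and_or_left]
    exact and_congr_right fun _ => by omega
  rw [h, Finset.card_union_of_disjoint, Finset.filter_eq']
  · split_ifs <;> simp
  · rw [Finset.disjoint_left]
    intro x
    simp only [Finset.mem_filter]
    omega

theorem card_filter_lt_insert (T : Finset ℕ) {s : ℕ} (hs : s ∉ T) (x : ℕ) :
    ((insert s T).filter (· < x)).card = (T.filter (· < x)).card + if s < x then 1 else 0 := by
  rw [Finset.filter_insert]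
  split_ifs
  · rw [Finset.card_insert_of_notMem (by simp [hs])]
  · rfl

/-- An entry that is at most D is fixed by its comparisons with all x ≤ D, and these are prescribed
by cardinalities. The counting form of `Enumerates` thus turns list manipulation into linear
arithmetic. -/
theorem Enumerates.eq {D : ℕ} {t t' : ℕ → ℕ} {T : Finset ℕ} (h : Enumerates D t T)
    (h' : Enumerates D t' T) : t = t' := by
  funext j
  have h1 := (h j).1
  have h1' := (h' j).1
  have h2 := ((h j).2 _ h1').trans ((h' j).2 _ h1').symm
  have h3 := ((h j).2 _ h1).trans ((h' j).2 _ h1).symm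
  omega

theorem Enumerates.mem_iff {D s : ℕ} {t : ℕ → ℕ} {T : Finset ℕ} (h : Enumerates D t T)
    (hs : s < D) : (∃ i, t i = s) ↔ s ∈ T := by
  have hsucc := card_filter_lt_succ T s
  constructor
  · rintro ⟨i, hi⟩
    have h1 := (h i).2 s hs.le
    have h2 := (h i).2 (s + 1) hs
    by_contra hsT
    rw [if_neg hsT] at hsucc
    omega
  · intro hsT
    rw [if_pos hsT] at hsucc
    have h1 := (h (T.filter (· < s)).card).2 s hs.le
    have h2 := (h (T.filter (· < s)).card).2 (s + 1) hs
    exact ⟨(T.filter (· < s)).card, by omega⟩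

/-- Toggling s changes the number of elements below x by one exactly when s < x. This matches a
shift of the list by one place, so the criterion at positions j - 1, j, j + 1 with thresholds x and
s settles all cases. -/
theorem Enumerates.toggle {D s : ℕ} {t : ℕ → ℕ} {T : Finset ℕ} (h : Enumerates D t T)
    (hs : s < D) : Enumerates D (toggle s t) (T ∆ {s}) := by
  intro j
  refine ⟨toggle_le hs.le (fun j => (h j).1) j, fun x hx => ?_⟩
  have hj := (h j).2
  have hj1 := (h (j - 1)).2
  have hj2 := (h (j + 1)).2
  have hsucc := card_filter_lt_succ T s
  have hmono : x ≤ s → (T.filter (· < x)).card ≤ (T.filter (· < s)).card :=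
    card_filter_lt_mono T
  have hmono' : s + 1 ≤ x → (T.filter (· < s + 1)).card ≤ (T.filter (· < x)).card :=
    card_filter_lt_mono T
  have a1 := hj x hx
  have a2 := hj s hs.le
  have a3 := hj1 x hx
  have a4 := hj1 s hs.le
  have a5 := hj2 x hx
  unfold Kikuchi.toggle
  rw [h.mem_iff hs]
  by_cases hsT : s ∈ T
  · have hT : insert s (T ∆ {s}) = T := by
      ext y
      simp only [Finset.mem_insert, Finset.mem_symmDiff, Finset.mem_singleton]
      by_cases hy : y = s
      · simp [hy, hsT]
      · simp [hy]
    have hcard := card_filter_lt_insert (T ∆ {s}) (s := s)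
      (by simp [Finset.mem_symmDiff, hsT]) x
    rw [hT] at hcard
    rw [if_pos hsT] at hsucc
    simp only [hsT, if_true]
    split_ifs at hcard ⊢ <;> omega
  · have hT : T ∆ {s} = insert s T := by
      ext y
      simp only [Finset.mem_insert, Finset.mem_symmDiff, Finset.mem_singleton]
      by_cases hy : y = s
      · simp [hy, hsT]
      · simp [hy]
    have hcard := card_filter_lt_insert T hsT x
    rw [if_neg hsT] at hsucc
    rw [hT]
    simp only [hsT, if_false]
    split_ifs at hcard ⊢ <;> omega

/-- Repetitions must be excluded: toggling an element twice would cancel, whereas `l.toFinset`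
counts it once. -/
theorem Enumerates.toggleList {D : ℕ} {l : List ℕ} {t : ℕ → ℕ} {T : Finset ℕ}
    (h : Enumerates D t T) (hl : ∀ s ∈ l, s < D) (hd : l.Nodup) :
    Enumerates D (toggleList l t) (T ∆ l.toFinset) := by
  induction l generalizing t T with
  | nil => simpa [Kikuchi.toggleList, ← Finset.bot_eq_empty] using h
  | cons s l ih =>
    have hT : T ∆ (s :: l).toFinset = (T ∆ {s}) ∆ l.toFinset := by
      rw [symmDiff_assoc]
      congr 1
      ext y
      have := (List.nodup_cons.1 hd).1
      simp only [List.toFinset_cons, Finset.mem_insert, Finset.mem_symmDiff,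
        Finset.mem_singleton, List.mem_toFinset]
      by_cases hy : y = s
      · simp [hy, this]
      · simp [hy]
    rw [hT]
    exact ih (h.toggle (hl s (by simp))) (fun s' hs' => hl s' (by simp [hs']))
      (List.nodup_cons.1 hd).2

/-! ## Programs that toggle -/

section Programs

variable {X : Type}

/-- The bits of the first `L` entries of a sequence. -/
def entryBits (L w : ℕ) (t : X → ℕ → ℕ) : Set (X → Prop) :=
  {f | ∃ j < L, ∃ p < w, f = fun x => (t x j).testBit p = true}

theorem HasProgram.entryBits {B : Set (X → Prop)} {L w g : ℕ} {t : X → ℕ → ℕ}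
    (h : ∀ j < L, ∀ p < w, HasProgram B {fun x => (t x j).testBit p = true} g) :
    HasProgram B (entryBits L w t) (L * (w * g)) :=
  (HasProgram.iUnion fun j hj => HasProgram.iUnion (h j hj)).mono subset_rfl
    (fun _ ⟨j, hj, p, hp, hf⟩ => ⟨j, hj, p, hp, hf⟩) le_rfl

/-- The two constant predicates. -/
def constants : Set (X → Prop) := {f | ∃ P : Prop, f = fun _ => P}

theorem HasProgram.const {B : Set (X → Prop)} : HasProgram B constants 3 := by
  refine (HasProgram.const_true.union HasProgram.const_false).mono subset_rfl ?_ le_rfl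
  rintro f ⟨P, rfl⟩
  by_cases hP : P <;> simp [hP]

theorem HasProgram.of_constants {B : Set (X → Prop)} (h : constants ⊆ B) (P : Prop) :
    HasProgram B {fun _ => P} 0 :=
  .of_mem (h ⟨P, rfl⟩)

/-- The comparisons with s and the membership test are computed once and shared by all output bits,
which keeps the size linear in the number of bits. The width is w + 1 because the sentinel 2^w must
be stored as well. -/
theorem HasProgram.toggle {L w s : ℕ} {t : X → ℕ → ℕ} (hs : s < 2 ^ w) (ht : ∀ x j, t x j ≤ 2 ^ w)
    (htL : ∀ x, ∀ j ≥ L, t x j = 2 ^ w) :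
    HasProgram (Kikuchi.entryBits L (w + 1) t)
      (Kikuchi.entryBits L (w + 1) fun x => Kikuchi.toggle s (t x)) (79 * (L + 1) * (w + 1)) := by
  set B := Kikuchi.entryBits L (w + 1) t with hB
  have hlt : 2 ^ w < 2 ^ (w + 1) := Nat.pow_lt_pow_right (by omega) (by omega)
  have hbit : ∀ B' ⊇ B, Kikuchi.constants ⊆ B' → ∀ j, ∀ p < w + 1,
      HasProgram B' {fun x => (t x j).testBit p = true} 0 := by
    intro B' hB' hc j p hp
    by_cases hj : j < L
    · exact .of_mem (hB' ⟨j, hj, p, hp, rfl⟩)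
    · simp only [htL _ j (by omega)]
      exact .of_constants hc _
  set B1 := B ∪ Kikuchi.constants with hB1
  have hlts : HasProgram B1 {f | ∃ j < L, f ∈ ({fun x => t x j < s} : Set (X → Prop))}
      (L * (14 * (w + 1) + 2)) :=
    .iUnion fun j _ => .lt (hbit B1 Set.subset_union_left Set.subset_union_right j)
      (fun p _ => .of_constants Set.subset_union_right _) (fun x => (ht x j).trans_lt hlt)
      fun _ => by omega
  have hmem : HasProgram B1 {fun x => ∃ j < L, t x j = s}
      (L * (28 * (w + 1) + 7 + 1) + L + 2) :=
    .exists fun j _ => .eq (hbit B1 Set.subset_union_left Set.subset_union_right j)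
      (fun p _ => .of_constants Set.subset_union_right _) (fun x => (ht x j).trans_lt hlt)
      fun _ => by omega
  -- Each output bit is three nested case distinctions on known bits, of 7 instructions each: hence
  -- 21.
  refine (HasProgram.const.comp ((hlts.union hmem).comp (HasProgram.entryBits (g := 21)
    fun j hj p hp => ?_))).mono subset_rfl subset_rfl ?_
  · set B2 := B1 ∪ _ with hB2
    have hc : Kikuchi.constants ⊆ B2 :=
      Set.subset_union_right.trans (Set.subset_union_left (s := B1))
    have hb := hbit B2 (Set.subset_union_left.trans (Set.subset_union_left (s := B1))) hc
    have hl : ∀ j < L, (fun x => t x j < s) ∈ B2 := fun j hj => .inr (.inl ⟨j, hj, rfl⟩)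
    have hcond : HasProgram B2 {fun x => j = 0 ∨ t x (j - 1) < s} 0 := by
      by_cases hj0 : j = 0
      · simp only [hj0, true_or]
        exact .of_constants hc _
      · simp only [hj0, false_or]
        exact .of_mem (hl _ (by omega))
    refine (HasProgram.ite (.of_mem (hl j hj)) (hb j p hp) (HasProgram.ite
      (.of_mem (.inr (.inr rfl))) (hb (j + 1) p hp) (HasProgram.ite hcond
      (.of_constants hc (s.testBit p = true)) (hb (j - 1) p hp)))).mono subset_rfl ?_ (by omega)
    rw [Set.singleton_subset_iff, Set.mem_singleton_iff]
    funext x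
    -- Beyond L only the sentinel 2^w > s occurs, so the search can be bounded.
    have hex : (∃ i, t x i = s) ↔ ∃ i < L, t x i = s := by
      refine ⟨fun ⟨i, hi⟩ => ⟨i, ?_, hi⟩, fun ⟨i, _, hi⟩ => ⟨i, hi⟩⟩
      by_contra hiL
      rw [htL x i (by omega)] at hi
      omega
    unfold Kikuchi.toggle
    rw [hex]
    by_cases c1 : t x j < s
    · simp only [c1, if_true, true_and, not_true, false_and, or_false]
    · by_cases c2 : ∃ i < L, t x i = s
      · simp only [c1, c2, if_true, if_false, true_and, not_true, false_and, or_false,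
          false_or, not_false_iff]
      · by_cases c3 : j = 0 ∨ t x (j - 1) < s
        · simp only [c1, c2, c3, if_true, if_false, true_and, not_true, false_and,
            or_false, false_or, not_false_iff]
        · simp only [c1, c2, c3, if_false, true_and, false_and,
            false_or, not_false_iff]
  · have : L * (14 * (w + 1) + 2) = 14 * (L * (w + 1)) + 2 * L := by ring
    have : L * (28 * (w + 1) + 7 + 1) = 28 * (L * (w + 1)) + 8 * L := by ring
    have : L * ((w + 1) * 21) = 21 * (L * (w + 1)) := by ring
    have : 79 * (L + 1) * (w + 1) = 79 * (L * (w + 1)) + 79 * (w + 1) := by ring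
    have : L ≤ L * (w + 1) := Nat.le_mul_of_pos_right _ (by omega)
    omega

/-- Each toggle may lengthen the list by one. L' bounds the current length, while the window L is
wide enough from the start for all insertions. -/
theorem HasProgram.toggleList {L L' w : ℕ} {l : List ℕ} (hl : ∀ s ∈ l, s < 2 ^ w)
    (hL : L' + l.length ≤ L) {t : X → ℕ → ℕ} (ht : ∀ x j, t x j ≤ 2 ^ w)
    (htL : ∀ x, ∀ j ≥ L', t x j = 2 ^ w) :
    HasProgram (Kikuchi.entryBits L (w + 1) t)
      (Kikuchi.entryBits L (w + 1) fun x => Kikuchi.toggleList l (t x))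
      (l.length * (79 * (L + 1) * (w + 1))) := by
  induction l generalizing t L' with
  | nil => exact (HasProgram.of_subset subset_rfl).mono subset_rfl subset_rfl (by simp)
  | cons s l ih =>
    simp only [List.length_cons] at hL
    have hs := hl s (by simp)
    have h1 := HasProgram.toggle (L := L) hs ht fun x j hj => htL x j (by omega)
    have h2 := ih (fun s' hs' => hl s' (by simp [hs'])) (L' := L' + 1) (by omega)
      (t := fun x => Kikuchi.toggle s (t x)) (fun x => toggle_le hs.le (ht x))
      (fun x j hj => toggle_eq hs.le (htL x) j hj)
    refine (h1.comp (h2.mono Set.subset_union_right subset_rfl le_rfl)).mono subset_rfl subset_rfl ?_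
    rw [List.length_cons, Nat.succ_mul l.length, add_comm]

end Programs

/-! ## Codes of sets -/

section Codes

variable {n ℓ : ℕ}

/-- The sequence of the `ℓ` numbers that a bit string stores, followed by the value
`2 ^ ⌈log₂ n⌉`. -/
def entries (i : Bits (numQubits n ℓ)) (j : ℕ) : ℕ :=
  if h : j < ℓ then Nat.ofBits fun p : Fin (Nat.clog 2 n) => i (finProdFinEquiv (⟨j, h⟩, p))
  else 2 ^ Nat.clog 2 n

/-- The bit string is the code of a set. -/
def IsCode (i : Bits (numQubits n ℓ)) : Prop := ∃ T : KSubset n ℓ, encodeSet T = i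

theorem entries_lt (i : Bits (numQubits n ℓ)) {j : ℕ} (h : j < ℓ) :
    entries i j < 2 ^ Nat.clog 2 n := by
  rw [entries, dif_pos h]
  exact Nat.ofBits_lt_two_pow _

theorem entries_of_le (i : Bits (numQubits n ℓ)) {j : ℕ} (h : ℓ ≤ j) :
    entries i j = 2 ^ Nat.clog 2 n := by
  rw [entries, dif_neg (by omega)]

theorem entries_le (i : Bits (numQubits n ℓ)) (j : ℕ) : entries i j ≤ 2 ^ Nat.clog 2 n := by
  by_cases h : j < ℓ
  · exact (entries_lt i h).le
  · exact (entries_of_le i (by omega)).le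

theorem testBit_entries_of_lt (i : Bits (numQubits n ℓ)) {j p : ℕ} (hj : j < ℓ)
    (hp : p < Nat.clog 2 n) :
    (entries i j).testBit p = i (finProdFinEquiv (⟨j, hj⟩, ⟨p, hp⟩)) := by
  rw [entries, dif_pos hj, Nat.testBit_ofBits_lt _ _ hp]

theorem testBit_entries (i : Bits (numQubits n ℓ)) (q : Fin (numQubits n ℓ)) :
    (entries i (finProdFinEquiv.symm q).1).testBit (finProdFinEquiv.symm q).2 = i q := by
  rw [testBit_entries_of_lt i (finProdFinEquiv.symm q).1.2 (finProdFinEquiv.symm q).2.2]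
  exact congrArg i (finProdFinEquiv.apply_symm_apply q)

theorem entries_encodeSet (T : KSubset n ℓ) {j : ℕ} (h : j < ℓ) :
    entries (encodeSet T) j = (T.1.orderEmbOfFin T.2 ⟨j, h⟩ : Fin n) := by
  have hn : ((T.1.orderEmbOfFin T.2 ⟨j, h⟩ : Fin n) : ℕ) < 2 ^ Nat.clog 2 n :=
    (Fin.is_lt _).trans_le (Nat.le_pow_clog (by omega) n)
  rw [entries, dif_pos h, ← Nat.mod_eq_of_lt hn, ← Nat.ofBits_testBit]
  congr 1
  funext p
  simp [encodeSet, natBits]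

/-- A strictly increasing list of ℓ numbers below n is the sorted enumeration of its image, by
uniqueness of that enumeration. Codes are thereby recognized by O(ℓ) comparisons of adjacent
entries. -/
theorem isCode_iff (i : Bits (numQubits n ℓ)) :
    IsCode i ↔ (∀ j < ℓ, entries i j < n) ∧ ∀ j < ℓ - 1, entries i j < entries i (j + 1) := by
  constructor
  · rintro ⟨T, rfl⟩
    refine ⟨fun j hj => ?_, fun j hj => ?_⟩
    · rw [entries_encodeSet T hj]
      exact Fin.is_lt _
    · rw [entries_encodeSet T (show j < ℓ by omega), entries_encodeSet T (show j + 1 < ℓ by omega),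
        Fin.val_fin_lt, OrderEmbedding.lt_iff_lt]
      simp
  · rintro ⟨hn, hlt⟩
    let f : Fin ℓ → Fin n := fun j => ⟨entries i j, hn j j.2⟩
    have hf : StrictMono f := by
      have key : ∀ d a, a + d + 1 < ℓ → entries i a < entries i (a + d + 1) := by
        intro d
        induction d with
        | zero => exact fun a ha => hlt a (by omega)
        | succ d ih =>
          exact fun a ha => (ih a (by omega)).trans (hlt (a + d + 1) (by omega))
      intro a b hab
      have hab' : (a : ℕ) < b := hab
      have := key (b - a - 1) a (by omega)
      rwa [show (a : ℕ) + (b - a - 1) + 1 = b by omega] at this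
    refine ⟨⟨Finset.univ.image f, by
      rw [Finset.card_image_of_injective _ hf.injective, Finset.card_univ, Fintype.card_fin]⟩, ?_⟩
    funext q
    rw [encodeSet, ← Finset.orderEmbOfFin_unique _ (fun x => by simp) hf, ← testBit_entries i q]
    rfl

/-- By monotonicity, entry j is below x exactly when the first j + 1 elements are; the initial
segments `Finset.Iic` and `Finset.Iio` give the two inequalities. -/
theorem enumerates_entries (T : KSubset n ℓ) :
    Enumerates (2 ^ Nat.clog 2 n) (entries (encodeSet T)) (T.1.map Fin.valEmbedding) := by
  intro j
  refine ⟨entries_le _ j, fun x hx => ?_⟩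
  set e := T.1.orderEmbOfFin T.2 with he
  have hT : (T.1.map Fin.valEmbedding).filter (· < x) =
      (Finset.univ.filter fun a => (e a : ℕ) < x).image fun a => (e a : ℕ) := by
    have h1 : T.1.map Fin.valEmbedding = Finset.univ.image fun a => (e a : ℕ) := by
      conv_lhs => rw [← Finset.image_orderEmbOfFin_univ T.1 T.2]
      rw [Finset.map_eq_image, Finset.image_image]
      rfl
    rw [h1, Finset.filter_image]
  rw [hT, Finset.card_image_of_injective _ (fun a b hab => e.injective (Fin.ext hab))]
  by_cases hj : j < ℓ
  · rw [entries_encodeSet T hj, ← he]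
    constructor
    · intro hlt
      have : (Finset.Iic (⟨j, hj⟩ : Fin ℓ)).card ≤
          (Finset.univ.filter fun a => (e a : ℕ) < x).card := by
        refine Finset.card_le_card fun a ha => ?_
        rw [Finset.mem_Iic] at ha
        rw [Finset.mem_filter]
        exact ⟨Finset.mem_univ _, lt_of_le_of_lt (Fin.val_fin_le.2 (e.monotone ha)) hlt⟩
      rw [Fin.card_Iic] at this
      exact this
    · intro hlt
      by_contra hge
      have : (Finset.univ.filter fun a => (e a : ℕ) < x).card ≤
          (Finset.Iio (⟨j, hj⟩ : Fin ℓ)).card := by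
        refine Finset.card_le_card fun a ha => ?_
        rw [Finset.mem_filter] at ha
        rw [Finset.mem_Iio, ← e.lt_iff_lt, ← Fin.val_fin_lt]
        exact ha.2.trans_le (not_lt.1 hge)
      rw [Fin.card_Iio] at this
      simp only at this
      omega
  · rw [entries_of_le _ (by omega)]
    have : (Finset.univ.filter fun a => (e a : ℕ) < x).card ≤ ℓ := by
      simpa using Finset.card_le_univ (Finset.univ.filter fun a => (e a : ℕ) < x)
    omega

theorem encodeSet_injective : Function.Injective (encodeSet (n := n) (ℓ := ℓ)) := by
  intro T U h
  have hTU : T.1.orderEmbOfFin T.2 = U.1.orderEmbOfFin U.2 := by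
    ext j
    rw [← entries_encodeSet T j.2, ← entries_encodeSet U j.2, h]
  apply Subtype.ext
  rw [← Finset.image_orderEmbOfFin_univ T.1 T.2, hTU, Finset.image_orderEmbOfFin_univ]

/-! ## The neighbour of a set in a Kikuchi matching -/

variable {k : ℕ}

/-- The list of stored numbers after all elements of `S` have been toggled. -/
noncomputable def toggledEntries (S : KSubset n k) (i : Bits (numQubits n ℓ)) : ℕ → ℕ :=
  toggleList (S.1.toList.map Fin.val) (entries i)

/-- The string `i` is the code of a set that has a neighbour in the Kikuchi matching of `S`. -/
def IsMatched (S : KSubset n k) (i : Bits (numQubits n ℓ)) : Prop :=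
  IsCode i ∧ toggledEntries S i (ℓ - 1) < 2 ^ Nat.clog 2 n ∧
    ¬toggledEntries S i ℓ < 2 ^ Nat.clog 2 n

/-- The code of the neighbour in the Kikuchi matching of `S`. -/
noncomputable def neighbor (S : KSubset n k) (i : Bits (numQubits n ℓ)) : Bits (numQubits n ℓ) :=
  fun q => (toggledEntries S i (finProdFinEquiv.symm q).1).testBit (finProdFinEquiv.symm q).2

theorem enumerates_toggledEntries (S : KSubset n k) (T : KSubset n ℓ) :
    Enumerates (2 ^ Nat.clog 2 n) (toggledEntries S (encodeSet T))
      ((T.1 ∆ S.1).map Fin.valEmbedding) := by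
  have h := (enumerates_entries T).toggleList (l := S.1.toList.map Fin.val) (by
    intro s hs
    obtain ⟨a, -, rfl⟩ := List.mem_map.1 hs
    exact a.2.trans_le (Nat.le_pow_clog (by omega) n))
    ((List.nodup_map_iff Fin.val_injective).2 (Finset.nodup_toList _))
  have hset : (T.1 ∆ S.1).map Fin.valEmbedding =
      T.1.map Fin.valEmbedding ∆ (S.1.toList.map Fin.val).toFinset := ?_
  · rw [hset]
    exact h
  ext x
  simp only [Finset.mem_map, Finset.mem_symmDiff, List.mem_toFinset, List.mem_map,
    Finset.mem_toList, Fin.valEmbedding_apply]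
  constructor
  · rintro ⟨a, h | h, rfl⟩
    · refine .inl ⟨⟨a, h.1, rfl⟩, ?_⟩
      rintro ⟨b, hb, hab⟩
      exact h.2 (Fin.ext hab ▸ hb)
    · refine .inr ⟨⟨a, h.1, rfl⟩, ?_⟩
      rintro ⟨b, hb, hab⟩
      exact h.2 (Fin.ext hab ▸ hb)
  · rintro (⟨⟨a, ha, rfl⟩, h⟩ | ⟨⟨a, ha, rfl⟩, h⟩)
    · exact ⟨a, .inl ⟨ha, fun h' => h ⟨a, h', rfl⟩⟩, rfl⟩
    · exact ⟨a, .inr ⟨ha, fun h' => h ⟨a, h', rfl⟩⟩, rfl⟩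

/-- All elements lie below the sentinel, so a genuine entry at position ℓ - 1 means at least ℓ
elements and a sentinel at position ℓ means at most ℓ. Positivity of ℓ keeps ℓ - 1 from being
truncated. -/
theorem isMatched_encodeSet_iff (hℓ : 0 < ℓ) (S : KSubset n k) (T : KSubset n ℓ) :
    IsMatched S (encodeSet T) ↔ (T.1 ∆ S.1).card = ℓ := by
  have h := enumerates_toggledEntries S T
  have hcard : (((T.1 ∆ S.1).map Fin.valEmbedding).filter (· < 2 ^ Nat.clog 2 n)).card =
      (T.1 ∆ S.1).card := by
    rw [Finset.filter_true_of_mem, Finset.card_map]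
    intro x hx
    obtain ⟨a, -, rfl⟩ := Finset.mem_map.1 hx
    exact a.2.trans_le (Nat.le_pow_clog (by omega) n)
  have h1 := (h (ℓ - 1)).2 _ le_rfl
  have h2 := (h ℓ).2 _ le_rfl
  rw [hcard] at h1 h2
  rw [IsMatched, h1, h2]
  constructor
  · rintro ⟨-, h3, h4⟩
    omega
  · intro h3
    exact ⟨⟨T, rfl⟩, by omega, by omega⟩

theorem neighbor_encodeSet {S : KSubset n k} {T U : KSubset n ℓ} (h : T.1 ∆ S.1 = U.1) :
    neighbor S (encodeSet T) = encodeSet U := by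
  have h1 := enumerates_toggledEntries S T
  rw [h] at h1
  funext q
  rw [neighbor, h1.eq (enumerates_entries U), testBit_entries]

/-- The k toggles dominate, at O(k (ℓ + k) w) instructions with w = ⌈log₂ n⌉, and k ≤ 2ℓ makes this
O(k N). Strings that are not codes need no special treatment: their entries are still at most 2^w,
which is all the programs use, and the validity test rejects them. -/
theorem HasProgram.neighbor {X : Type} {B : Set (X → Prop)} (i : X → Bits (numQubits n ℓ))
    (hi : ∀ q, (fun x => i x q = true) ∈ B) (hk : 0 < k) (hkℓ : k ≤ 2 * ℓ) (hn : 2 ≤ n)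
    (S : KSubset n k) :
    HasProgram B ({fun x => IsMatched S (i x)} ∪
      {f | ∃ q, f = fun x => Kikuchi.neighbor S (i x) q = true})
      (640 * (k + 1) * numQubits n ℓ) := by
  set w := Nat.clog 2 n with hw
  have hw1 : 1 ≤ w := Nat.clog_pos (by omega) hn
  have hwlt : 2 ^ w < 2 ^ (w + 1) := Nat.pow_lt_pow_right (by omega) (by omega)
  have hnw : n ≤ 2 ^ w := Nat.le_pow_clog (by omega) n
  have hent : Kikuchi.entryBits (ℓ + k) (w + 1) (fun x => entries (i x)) ⊆
      B ∪ Kikuchi.constants := by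
    rintro f ⟨j, -, p, -, rfl⟩
    by_cases hj : j < ℓ
    · by_cases hp : p < w
      · refine .inl ?_
        have := hi (finProdFinEquiv (⟨j, hj⟩, ⟨p, hp⟩))
        simpa only [testBit_entries_of_lt _ hj hp] using this
      · refine .inr ⟨False, ?_⟩
        funext x
        rw [Nat.testBit_lt_two_pow ((entries_lt (i x) hj).trans_le
          (Nat.pow_le_pow_right (by omega) (by omega)))]
        simp
    · refine .inr ⟨(2 ^ w).testBit p = true, ?_⟩
      funext x
      simp only [entries_of_le (i x) (not_lt.1 hj), hw]
  have htog : HasProgram (B ∪ Kikuchi.constants)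
      (Kikuchi.entryBits (ℓ + k) (w + 1) fun x => toggledEntries S (i x))
      (k * (79 * (ℓ + k + 1) * (w + 1))) := by
    refine (HasProgram.toggleList (L := ℓ + k) (L' := ℓ) (w := w) (t := fun x => entries (i x))
      (l := S.1.toList.map Fin.val) ?_ (by simp [S.2]) (fun x => entries_le (i x))
      (fun x j => entries_of_le (i x))).mono hent subset_rfl (by simp [S.2])
    intro s hs
    obtain ⟨a, -, rfl⟩ := List.mem_map.1 hs
    exact a.2.trans_le hnw
  set B1 := (B ∪ Kikuchi.constants) ∪
    Kikuchi.entryBits (ℓ + k) (w + 1) fun x => toggledEntries S (i x) with hB1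
  have hc : Kikuchi.constants ⊆ B1 :=
    Set.subset_union_right.trans (Set.subset_union_left (s := B ∪ Kikuchi.constants))
  have hent1 : ∀ j < ℓ, ∀ p < w + 1, HasProgram B1 {fun x => (entries (i x) j).testBit p = true} 0 :=
    fun j hj p hp => .of_mem (.inl (hent ⟨j, by omega, p, hp, rfl⟩))
  have htog1 : ∀ j < ℓ + k, ∀ p < w + 1,
      HasProgram B1 {fun x => (toggledEntries S (i x) j).testBit p = true} 0 :=
    fun j hj p hp => .of_mem (.inr ⟨j, hj, p, hp, rfl⟩)
  have hle : ∀ x j, entries (i x) j < 2 ^ (w + 1) := fun x j => (entries_le (i x) j).trans_lt hwlt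
  have htle : ∀ x j, toggledEntries S (i x) j < 2 ^ (w + 1) := fun x j =>
    (toggleList_le (fun s hs => by
      obtain ⟨a, -, rfl⟩ := List.mem_map.1 hs
      exact (a.2.trans_le hnw).le) (entries_le (i x)) j).trans_lt hwlt
  have hv1 : HasProgram B1 {fun x => ∀ j < ℓ, entries (i x) j < n}
      (ℓ * (14 * (w + 1) + 2) + ℓ + 1) :=
    .forall fun j hj => .lt (hent1 j hj) (fun p _ => .of_constants hc _) (fun x => hle x j)
      fun _ => by omega
  have hv2 : HasProgram B1 {fun x => ∀ j < ℓ - 1, entries (i x) j < entries (i x) (j + 1)}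
      ((ℓ - 1) * (14 * (w + 1) + 2) + (ℓ - 1) + 1) :=
    .forall fun j hj => .lt (hent1 j (by omega)) (hent1 (j + 1) (by omega)) (fun x => hle x j)
      fun x => hle x (j + 1)
  have hlt : ∀ j < ℓ + k, HasProgram B1 {fun x => toggledEntries S (i x) j < 2 ^ w}
      (14 * (w + 1) + 2) := fun j hj =>
    .lt (htog1 j hj) (fun p _ => .of_constants hc _) (fun x => htle x j) fun _ => hwlt
  have hm : HasProgram B1 {fun x => IsMatched S (i x)}
      (ℓ * (14 * (w + 1) + 2) + ℓ + 1 + ((ℓ - 1) * (14 * (w + 1) + 2) + (ℓ - 1) + 1) + 1 +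
        (14 * (w + 1) + 2 + (14 * (w + 1) + 2 + 1) + 1) + 1) := by
    simp only [IsMatched, isCode_iff]
    exact (hv1.and hv2).and ((hlt (ℓ - 1) (by omega)).and (hlt ℓ (by omega)).not)
  have hfin := HasProgram.const.comp (htog.comp (hm.union (.of_subset
    (F := {f | ∃ q, f = fun x => Kikuchi.neighbor S (i x) q = true}) ?_)))
  · refine hfin.mono subset_rfl subset_rfl ?_
    have e0 : (ℓ - 1) * (14 * (w + 1) + 2) ≤ ℓ * (14 * (w + 1) + 2) :=
      Nat.mul_le_mul_right _ (by omega)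
    have e1 : ℓ * (14 * (w + 1) + 2) = 14 * (ℓ * (w + 1)) + 2 * ℓ := by ring
    have e2 : ℓ ≤ ℓ * (w + 1) := Nat.le_mul_of_pos_right _ (by omega)
    have e3 : w + 1 ≤ ℓ * (w + 1) := Nat.le_mul_of_pos_left _ (by omega)
    have e4 : k * (79 * (ℓ + k + 1) * (w + 1)) = 79 * (k * ((ℓ + k + 1) * (w + 1))) := by ring
    have e5 : (ℓ + k + 1) * (w + 1) ≤ 8 * (ℓ * w) := by
      have : (ℓ + k + 1) * (w + 1) ≤ (4 * ℓ) * (2 * w) := Nat.mul_le_mul (by omega) (by omega)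
      linarith
    have e6 := Nat.mul_le_mul_left k e5
    have e7 : ℓ * (w + 1) = ℓ * w + ℓ := by ring
    have e8 : ℓ ≤ ℓ * w := Nat.le_mul_of_pos_right _ (by omega)
    have e9 : k * (8 * (ℓ * w)) = 8 * (k * (ℓ * w)) := by ring
    have e10 : 640 * (k + 1) * numQubits n ℓ = 640 * (k * (ℓ * w)) + 640 * (ℓ * w) := by
      rw [numQubits, ← hw]
      ring
    omega
  · rintro f ⟨q, rfl⟩
    exact .inr ⟨_, by have := (finProdFinEquiv.symm q).1.2; omega, _,
      by have := (finProdFinEquiv.symm q).2.2; omega, rfl⟩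

end Codes

/-! ## Sparse Hamiltonians whose neighbours are computed by small programs -/

/-- The nonzero entries of `H` in row `i` are among `val r` in column `nb r i`, where `r` runs
over the elements of `L` with `P r i`, and `P r` and `nb r` have programs of size `G`. -/
structure NeighborPrograms {N : ℕ} {ι : Type} (H : Matrix (Bits N) (Bits N) ℝ) (L : List ι)
    (P : ι → Bits N → Prop) (nb : ι → Bits N → Bits N) (val : ι → ℝ) (G : ℕ) : Prop where
  nodup : L.Nodup
  apply_eq : ∀ r ∈ L, ∀ i, P r i → H i (nb r i) = val r
  exists_of_ne_zero : ∀ i j, H i j ≠ 0 → ∃ r ∈ L, P r i ∧ nb r i = j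
  injective : ∀ i, ∀ r ∈ L, ∀ r' ∈ L, P r i → P r' i → nb r i = nb r' i → r = r'
  -- The register is left general because the two oracles read the row from different registers.
  program : ∀ r ∈ L, ∀ (X : Type) (B : Set (X → Prop)) (i : X → Bits N),
    (∀ q, (fun x => i x q = true) ∈ B) →
    HasProgram B ({fun x => P r (i x)} ∪ {f | ∃ q, f = fun x => nb r (i x) q = true}) G

theorem roundBits_zero (b : ℕ) (p : Fin (b + 2)) : roundBits b 0 p = false := by
  simp [roundBits]

/-! ### The adjacency matrix oracle -/

section Oracles

variable {N : ℕ} {ι : Type} {H : Matrix (Bits N) (Bits N) ℝ} {L : List ι}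
  {P : ι → Bits N → Prop} {nb : ι → Bits N → Bits N} {val : ι → ℝ} {G : ℕ}

open Classical in
-- At most one r leads from i to j, so the disjunction has a single relevant term. If there is none,
-- the entry is zero and so are its rounded bits.
theorem NeighborPrograms.roundBits_eq (h : NeighborPrograms H L P nb val G) (b : ℕ)
    (i j : Bits N) (p : Fin (b + 2)) :
    roundBits b (H i j) p =
      decide (∃ r ∈ L, (P r i ∧ nb r i = j) ∧ roundBits b (val r) p = true) := by
  by_cases hH : ∃ r ∈ L, P r i ∧ nb r i = j
  · obtain ⟨r, hr, hP, rfl⟩ := hH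
    rw [h.apply_eq r hr i hP, Bool.eq_iff_iff, decide_eq_true_eq]
    constructor
    · exact fun hp => ⟨r, hr, ⟨hP, rfl⟩, hp⟩
    · rintro ⟨r', hr', ⟨hP', hnb⟩, hp⟩
      rwa [h.injective i r' hr' r hr hP' hP hnb] at hp
  · have h0 : H i j = 0 := by
      by_contra h0
      exact hH (h.exists_of_ne_zero i j h0)
    rw [h0, roundBits_zero, eq_comm, decide_eq_false_iff_not]
    rintro ⟨r, hr, hP, -⟩
    exact hH ⟨r, hr, hP⟩

/-- The position of a bit of the output of the adjacency matrix oracle. -/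
def outputWire (N b : ℕ) (p : Fin (b + 2)) : Fin N ⊕ Fin N ⊕ Fin (b + 2) := .inr (.inr p)

/-- The bits that `r` contributes to the output of the adjacency matrix oracle. -/
def entryBit (P : ι → Bits N → Prop) (nb : ι → Bits N → Bits N) (val : ι → ℝ) (b : ℕ) (r : ι)
    (p : Fin (b + 2)) (x : Fin N ⊕ Fin N ⊕ Fin (b + 2) → Bool) : Prop :=
  (P r (fun q => x (.inl q)) ∧ nb r (fun q => x (.inl q)) = fun q => x (.inr (.inl q))) ∧
    roundBits b (val r) p = true

theorem NeighborPrograms.revImpl_entryBit (h : NeighborPrograms H L P nb val G) (b : ℕ) {r : ι}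
    (hr : r ∈ L) :
    RevImpl (G + 8 * N + 4) (4 * (G + 8 * N + 4) + (b + 2))
      (xorInto (outputWire N b) (entryBit P nb val b r)) := by
  refine RevImpl.xorInto (fun p q hpq => Sum.inr_injective (Sum.inr_injective hpq)) ?_ le_rfl
  have hp := h.program r hr (Fin N ⊕ Fin N ⊕ Fin (b + 2) → Bool)
    {f | ∃ v, (∀ p, outputWire N b p ≠ v) ∧ f = fun x => x v = true} (fun x q => x (.inl q))
    fun q => ⟨.inl q, by simp [outputWire], rfl⟩
  refine (hp.comp
    (((HasProgram.of_mem (.inr (.inl rfl))).and (HasProgram.eq_bits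
      (fun q => .of_mem (.inr (.inr ⟨q, rfl⟩))) fun q => .of_mem
        (.inl ⟨.inr (.inl q), by simp [outputWire], rfl⟩))).union .const_false)).mono
    subset_rfl ?_ (by omega)
  rintro f ⟨p, rfl⟩
  -- The rounded value is known when the circuit is built: an output bit is either the match
  -- predicate itself or constantly false, so one conjunction serves all b + 2 bits.
  cases hp : roundBits b (val r) p
  · right
    rw [Set.mem_singleton_iff]
    funext x
    simp [entryBit, hp]
  · left
    rw [Set.mem_singleton_iff]
    funext x
    simp [entryBit, hp]

open Classical in
theorem xorInto_entryBit (b : ℕ) (r : ι) (i j : Bits N) (z : Bits (b + 2)) :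
    xorInto (outputWire N b) (entryBit P nb val b r) (Sum.elim i (Sum.elim j z)) =
      Sum.elim i (Sum.elim j fun p =>
        xor (z p) (decide ((P r i ∧ nb r i = j) ∧ roundBits b (val r) p = true))) := by
  funext v
  rcases v with v | v | v <;> simp [xorInto, outputWire, entryBit]

open Classical in
-- The loop produces an exclusive or of contributions, which is their disjunction because
-- injectivity of the neighbours lets at most one r contribute.
theorem foldl_xorInto_entryBit (b : ℕ) (hL : L.Nodup) (i j : Bits N)
    (hinj : ∀ r ∈ L, ∀ r' ∈ L, P r i → P r' i → nb r i = nb r' i → r = r') (z : Bits (b + 2)) :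
    L.foldl (fun x r => xorInto (outputWire N b) (entryBit P nb val b r) x)
        (Sum.elim i (Sum.elim j z)) =
      Sum.elim i (Sum.elim j fun p => xor (z p)
        (decide (∃ r ∈ L, (P r i ∧ nb r i = j) ∧ roundBits b (val r) p = true))) := by
  induction L generalizing z with
  | nil => simp
  | cons r L ih =>
    rw [List.foldl_cons, xorInto_entryBit, ih (List.nodup_cons.1 hL).2 fun r hr r' hr' =>
      hinj r (by simp [hr]) r' (by simp [hr'])]
    congr 2
    funext p
    rw [Bool.xor_assoc]
    congr 1
    by_cases hr : (P r i ∧ nb r i = j) ∧ roundBits b (val r) p = true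
    · have hno : ¬∃ r ∈ L, (P r i ∧ nb r i = j) ∧ roundBits b (val r) p = true := by
        rintro ⟨r', hr', ⟨hP', hnb'⟩, -⟩
        have := hinj r (by simp) r' (by simp [hr']) hr.1.1 hP' (hr.1.2.trans hnb'.symm)
        exact (List.nodup_cons.1 hL).1 (this ▸ hr')
      have hyes : ∃ r' ∈ r :: L, (P r' i ∧ nb r' i = j) ∧ roundBits b (val r') p = true :=
        ⟨r, by simp, hr⟩
      rw [decide_eq_true hr, decide_eq_false hno, decide_eq_true hyes]
      rfl
    · rw [decide_eq_false hr, Bool.false_xor, decide_eq_decide]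
      simp [hr]

theorem NeighborPrograms.hasOH (h : NeighborPrograms H L P nb val G) (b : ℕ) :
    HasOH H b (5 * (L.length * (4 * (G + 8 * N + 4) + (b + 2))) : ℕ)
      (2 * N + (b + 2) + (G + 8 * N + 4) : ℕ) := by
  obtain ⟨C, hC, hCx⟩ := (RevImpl.foldl (π := fun r => xorInto (outputWire N b)
    (entryBit P nb val b r)) L fun r hr => h.revImpl_entryBit b hr).exists_circuit
  refine ⟨_, C, fun i j z => ?_, by exact_mod_cast hC, ?_⟩
  · rw [hCx, foldl_xorInto_entryBit b h.nodup i j (h.injective i)]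
    simp only [h.roundBits_eq]
  · rw [Nat.cast_le]
    simp only [Fintype.card_sum, Fintype.card_fin]
    omega

/-! ## A binary counter -/

open Classical in
/-- Add `1` to the binary number `c` if `m` holds. -/
noncomputable def increment (m : Prop) (c : Bits N) : Bits N :=
  fun q => xor (c q) (decide (m ∧ ∀ q' < q, c q' = true))

/-- Position q is reached by a carry when all lower bits are 1, and then incrementing turns them all
into 0; conversely, zeros below q in the result can only come from ones. The carries can therefore
be recomputed from the new counter, and so erased. -/
theorem increment_borrow (m : Prop) (c : Bits N) (q : Fin N) :
    (m ∧ ∀ q' < q, ¬increment m c q' = true) ↔ m ∧ ∀ q' < q, c q' = true := by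
  refine and_congr_right fun hm => ⟨fun h => ?_, fun h q' hq' => ?_⟩
  · intro q'
    induction q' using WellFoundedLT.induction with
    | _ q' ih =>
      intro hq'
      have h1 : ∀ q'' < q', c q'' = true := fun q'' hq'' => ih q'' hq'' (hq''.trans hq')
      have h2 := h q' hq'
      have h3 : (m ∧ ∀ q'' < q', c q'' = true) = True := eq_true ⟨hm, h1⟩
      simp only [increment, h3] at h2
      simpa using h2
  · have : ∀ q'' < q', c q'' = true := fun q'' hq'' => h q'' (hq''.trans hq')
    simp [increment, hm, h q' hq']
    exact this

theorem testBit_succ (t q : ℕ) :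
    (t + 1).testBit q = xor (t.testBit q) (decide (∀ q' < q, t.testBit q' = true)) := by
  induction q generalizing t with
  | zero =>
    rcases Nat.mod_two_eq_zero_or_one t with h | h <;> simp [Nat.testBit_zero, Nat.add_mod, h]
  | succ q ih =>
    rw [Nat.testBit_succ, Nat.testBit_succ]
    rcases Nat.mod_two_eq_zero_or_one t with h | h
    · have : ¬∀ q' < q + 1, t.testBit q' = true := fun h' => by
        simpa [Nat.testBit_zero, h] using h' 0 (by omega)
      rw [decide_eq_false this, show (t + 1) / 2 = t / 2 by omega, Bool.xor_false]
    · rw [show (t + 1) / 2 = t / 2 + 1 by omega, ih]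
      congr 1
      rw [decide_eq_decide]
      constructor
      · intro h' q' hq'
        cases q' with
        | zero => simp [Nat.testBit_zero, h]
        | succ q' => rw [Nat.testBit_succ]; exact h' q' (by omega)
      · intro h' q' hq'
        rw [← Nat.testBit_succ]
        exact h' (q' + 1) (by omega)

theorem increment_natBits (m : Prop) [Decidable m] (t : ℕ) :
    increment m (natBits N t) = natBits N (if m then t + 1 else t) := by
  funext q
  by_cases hm : m
  · simp only [increment, natBits, hm, if_true, true_and, testBit_succ]
    congr 1
    rw [decide_eq_decide]
    exact ⟨fun h q' hq' => h ⟨q', by omega⟩ hq', fun h q' hq' => h q' hq'⟩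
  · simp [increment, hm]

theorem natBits_injOn {t t' : ℕ} (ht : t < 2 ^ N) (ht' : t' < 2 ^ N)
    (h : natBits N t = natBits N t') : t = t' := by
  apply Nat.eq_of_testBit_eq
  intro q
  by_cases hq : q < N
  · exact congrFun h ⟨q, hq⟩
  · have h2 : 2 ^ N ≤ 2 ^ q := Nat.pow_le_pow_right (by omega) (by omega)
    rw [Nat.testBit_lt_two_pow (by omega), Nat.testBit_lt_two_pow (by omega)]

end Oracles

section ListOracle

variable {N : ℕ} {ι : Type} {H : Matrix (Bits N) (Bits N) ℝ} {L : List ι}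
  {P : ι → Bits N → Prop} {nb : ι → Bits N → Bits N} {val : ι → ℝ} {G : ℕ}

/-! ## The adjacency list oracle -/

/-- The register of the adjacency list oracle, together with three ancillary registers. -/
abbrev ListRegister (N : ℕ) : Type := (Fin N ⊕ Fin 1 ⊕ Fin N) ⊕ (Fin N ⊕ Fin N ⊕ Fin N)

/-- The basis state with row `i`, flag `f`, index `K`, output `o`, counter `c` and carry `e`. -/
def listState (i : Bits N) (f : Bool) (K o c e : Bits N) : ListRegister N → Bool :=
  Sum.elim (Sum.elim i (Sum.elim (fun _ => f) K)) (Sum.elim o (Sum.elim c e))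

/-- The wires of the row. -/
def rowWire (q : Fin N) : ListRegister N := .inl (.inl q)

/-- The wire of the flag. -/
def flagWire (N : ℕ) (p : Fin 1) : ListRegister N := .inl (.inr (.inl p))

/-- The wires of the index. -/
def indexWire (q : Fin N) : ListRegister N := .inl (.inr (.inr q))

/-- The wires of the output buffer. -/
def bufferWire (q : Fin N) : ListRegister N := .inr (.inl q)

/-- The wires of the counter. -/
def counterWire (q : Fin N) : ListRegister N := .inr (.inr (.inl q))

/-- The wires of the carry bits. -/
def carryWire (q : Fin N) : ListRegister N := .inr (.inr (.inr q))

section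

variable (i : Bits N) (f : Bool) (K o c e : Bits N)

theorem listState_flagWire (p : Fin 1) : listState i f K o c e (flagWire N p) = f := rfl

theorem listState_indexWire (q : Fin N) : listState i f K o c e (indexWire q) = K q := rfl

theorem listState_carryWire (q : Fin N) : listState i f K o c e (carryWire q) = e q := rfl

theorem xorInto_flagWire {F : Fin 1 → (ListRegister N → Bool) → Prop} {b : Bool}
    (hb : F 0 (listState i f K o c e) ↔ b = true) :
    xorInto (flagWire N) F (listState i f K o c e) = listState i (xor f b) K o c e := by
  have hb' : (∃ p, flagWire N p = flagWire N 0 ∧ F p (listState i f K o c e)) ↔ b = true :=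
    ⟨fun ⟨p, _, hp⟩ => hb.1 (Subsingleton.elim p 0 ▸ hp), fun h => ⟨0, rfl, hb.2 h⟩⟩
  funext v
  rcases v with (v | v | v) | v | v | v
  · simp [xorInto, flagWire, listState]
  · rw [Subsingleton.elim v 0]
    change xor f _ = xor f b
    rw [Bool.xor_right_inj, Bool.eq_iff_iff]
    simp only [decide_eq_true_eq]
    exact hb'
  all_goals simp [xorInto, flagWire, listState]

theorem xorInto_indexWire {F : Fin N → (ListRegister N → Bool) → Prop} {b : Bits N}
    (hb : ∀ q, F q (listState i f K o c e) ↔ b q = true) :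
    xorInto indexWire F (listState i f K o c e) = listState i f (fun q => xor (K q) (b q)) o c e := by
  funext v
  rcases v with (v | v | v) | v | v | v <;> simp [xorInto, indexWire, hb] <;> rfl

theorem xorInto_bufferWire {F : Fin N → (ListRegister N → Bool) → Prop} {b : Bits N}
    (hb : ∀ q, F q (listState i f K o c e) ↔ b q = true) :
    xorInto bufferWire F (listState i f K o c e) = listState i f K (fun q => xor (o q) (b q)) c e := by
  funext v
  rcases v with (v | v | v) | v | v | v <;> simp [xorInto, bufferWire, hb] <;> rfl

theorem xorInto_counterWire {F : Fin N → (ListRegister N → Bool) → Prop} {b : Bits N}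
    (hb : ∀ q, F q (listState i f K o c e) ↔ b q = true) :
    xorInto counterWire F (listState i f K o c e) = listState i f K o (fun q => xor (c q) (b q)) e := by
  funext v
  rcases v with (v | v | v) | v | v | v <;> simp [xorInto, counterWire, hb] <;> rfl

theorem xorInto_carryWire {F : Fin N → (ListRegister N → Bool) → Prop} {b : Bits N}
    (hb : ∀ q, F q (listState i f K o c e) ↔ b q = true) :
    xorInto carryWire F (listState i f K o c e) = listState i f K o c (fun q => xor (e q) (b q)) := by
  funext v
  rcases v with (v | v | v) | v | v | v <;> simp [xorInto, carryWire, hb] <;> rfl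

end

/-- The neighbour `r` is the one at the position that the index register holds. -/
def IsHit (P : ι → Bits N → Prop) (r : ι) (x : ListRegister N → Bool) : Prop :=
  P r (fun q => x (rowWire q)) ∧ (fun q => x (counterWire q)) = fun q => x (indexWire q)

/-- If the neighbour `r` is at the right position, then copy it to the buffer. -/
noncomputable def copyNeighbor (P : ι → Bits N → Prop) (nb : ι → Bits N → Bits N) (r : ι) :
    (ListRegister N → Bool) → (ListRegister N → Bool) :=
  xorInto bufferWire fun q x => IsHit P r x ∧ nb r (fun q => x (rowWire q)) q = true

/-- If the neighbour `r` is at the right position, then flip the flag. -/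
noncomputable def flagNeighbor (P : ι → Bits N → Prop) (r : ι) :
    (ListRegister N → Bool) → (ListRegister N → Bool) :=
  xorInto (flagWire N) fun _ x => IsHit P r x

/-- Add the carry bits of the increment of the counter for the neighbour `r`. -/
noncomputable def carryNeighbor (P : ι → Bits N → Prop) (r : ι) :
    (ListRegister N → Bool) → (ListRegister N → Bool) :=
  xorInto carryWire fun q x =>
    P r (fun q => x (rowWire q)) ∧ ∀ q' < q, x (counterWire q') = true

/-- Add the carry bits of the decrement of the counter for the neighbour `r`. -/
noncomputable def borrowNeighbor (P : ι → Bits N → Prop) (r : ι) :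
    (ListRegister N → Bool) → (ListRegister N → Bool) :=
  xorInto carryWire fun q x =>
    P r (fun q => x (rowWire q)) ∧ ∀ q' < q, ¬x (counterWire q') = true

/-- Add the carry bits to the counter. -/
noncomputable def addCarry (N : ℕ) : (ListRegister N → Bool) → (ListRegister N → Bool) :=
  xorInto counterWire fun q x => x (carryWire q) = true

/-- If the buffer holds the neighbour `r`, then subtract the counter from the index. -/
noncomputable def eraseIndex (P : ι → Bits N → Prop) (nb : ι → Bits N → Bits N) (r : ι) :
    (ListRegister N → Bool) → (ListRegister N → Bool) :=
  xorInto indexWire fun q x =>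
    ((P r (fun q => x (rowWire q)) ∧ x (flagWire N 0) = true) ∧
      nb r (fun q => x (rowWire q)) = fun q => x (bufferWire q)) ∧ x (counterWire q) = true

/-- The body of the first loop: look for the neighbour with the given index. -/
noncomputable def forwardStep (P : ι → Bits N → Prop) (nb : ι → Bits N → Bits N) (r : ι) :
    (ListRegister N → Bool) → (ListRegister N → Bool) :=
  borrowNeighbor P r ∘ addCarry N ∘ carryNeighbor P r ∘ flagNeighbor P r ∘ copyNeighbor P nb r

/-- The body of the second loop: clear the counter, and the index if a neighbour was found. -/
noncomputable def backwardStep (P : ι → Bits N → Prop) (nb : ι → Bits N → Bits N) (r : ι) :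
    (ListRegister N → Bool) → (ListRegister N → Bool) :=
  eraseIndex P nb r ∘ carryNeighbor P r ∘ addCarry N ∘ borrowNeighbor P r

/-- Negate the flag and move the buffer to the index register. -/
noncomputable def finalStep (N : ℕ) : (ListRegister N → Bool) → (ListRegister N → Bool) :=
  (xorInto bufferWire fun q x => ¬x (flagWire N 0) = true ∧ x (indexWire q) = true) ∘
    (xorInto indexWire fun q x => x (bufferWire q) = true) ∘
      xorInto (flagWire N) fun _ _ => True

open Classical in
-- The counter is compared before it is incremented, so neighbours are numbered from 0. The borrows
-- of the new counter cancel the carries of the old one.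
theorem forwardStep_listState (r : ι) (i : Bits N) (f : Bool) (K o c : Bits N) :
    forwardStep P nb r (listState i f K o c fun _ => false) =
      listState i (xor f (decide (P r i ∧ c = K))) K
        (fun q => xor (o q) (decide ((P r i ∧ c = K) ∧ nb r i q = true)))
        (increment (P r i) c) fun _ => false := by
  simp only [forwardStep, Function.comp_apply]
  rw [copyNeighbor, xorInto_bufferWire (b := fun q => decide ((P r i ∧ c = K) ∧ nb r i q = true))
      (hb := fun q => by rw [decide_eq_true_iff]; rfl),
    flagNeighbor, xorInto_flagWire (b := decide (P r i ∧ c = K))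
      (hb := by rw [decide_eq_true_iff]; rfl),
    carryNeighbor, xorInto_carryWire (b := fun q => decide (P r i ∧ ∀ q' < q, c q' = true))
      (hb := fun q => by rw [decide_eq_true_iff]; rfl),
    addCarry, xorInto_counterWire (b := fun q => decide (P r i ∧ ∀ q' < q, c q' = true))
      (hb := fun q => by rw [listState_carryWire, Bool.false_xor]),
    borrowNeighbor, xorInto_carryWire (b := fun q => decide (P r i ∧ ∀ q' < q, c q' = true))
      (hb := fun q => (increment_borrow (P r i) c q).trans decide_eq_true_iff.symm)]
  simp only [Bool.false_xor, Bool.xor_self]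
  rfl

open Classical in
-- The counter is decremented before the erasure, so what is added to the index is the number of
-- matched elements preceding r.
theorem backwardStep_listState (r : ι) (i : Bits N) (f : Bool) (K o c : Bits N) :
    backwardStep P nb r (listState i f K o (increment (P r i) c) fun _ => false) =
      listState i f
        (fun q => xor (K q) (decide (((P r i ∧ f = true) ∧ nb r i = o) ∧ c q = true))) o c
        fun _ => false := by
  have hc : (fun q => xor (increment (P r i) c q)
      (decide (P r i ∧ ∀ q' < q, c q' = true))) = c := by
    funext q
    simp [increment]
  simp only [backwardStep, Function.comp_apply]
  rw [borrowNeighbor, xorInto_carryWire (b := fun q => decide (P r i ∧ ∀ q' < q, c q' = true))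
      (hb := fun q => (increment_borrow (P r i) c q).trans decide_eq_true_iff.symm),
    addCarry, xorInto_counterWire (b := fun q => decide (P r i ∧ ∀ q' < q, c q' = true))
      (hb := fun q => by rw [listState_carryWire, Bool.false_xor]), hc,
    carryNeighbor, xorInto_carryWire (b := fun q => decide (P r i ∧ ∀ q' < q, c q' = true))
      (hb := fun q => by rw [decide_eq_true_iff]; rfl),
    eraseIndex, xorInto_indexWire
      (b := fun q => decide (((P r i ∧ f = true) ∧ nb r i = o) ∧ c q = true))
      (hb := fun q => by rw [decide_eq_true_iff]; rfl)]
  simp only [Bool.false_xor, Bool.xor_self]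

/-- Since the index has been erased, adding the buffer to it copies the buffer, and adding the copy
back clears the buffer. -/
theorem finalStep_listState_true (i o c e : Bits N) :
    finalStep N (listState i true (fun _ => false) o c e) =
      listState i false o (fun _ => false) c e := by
  simp only [finalStep, Function.comp_apply]
  rw [xorInto_flagWire (b := true) (hb := by simp), xorInto_indexWire (b := o)
      (hb := fun q => Iff.rfl), xorInto_bufferWire (b := o)
      (hb := fun q => by simp [listState_flagWire, listState_indexWire])]
  simp

/-- The buffer is empty and the index must survive; the flag suppresses the second addition, which
would otherwise copy the index to the buffer. -/
theorem finalStep_listState_false (i K c e : Bits N) :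
    finalStep N (listState i false K (fun _ => false) c e) =
      listState i true K (fun _ => false) c e := by
  simp only [finalStep, Function.comp_apply]
  rw [xorInto_flagWire (b := true) (hb := by simp), xorInto_indexWire (b := fun _ => false)
      (hb := fun q => Iff.rfl), xorInto_bufferWire (b := fun _ => false)
      (hb := fun q => by simp [listState_flagWire])]
  simp

/-! ### Correctness of the two loops -/

section Loops

open Classical

/-- The elements of `L` that yield a neighbour of `i`. -/
noncomputable def matchedList (P : ι → Bits N → Prop) (i : Bits N) (L : List ι) : List ι :=
  L.filter fun r => decide (P r i)

theorem mem_matchedList {i : Bits N} {L : List ι} {r : ι} :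
    r ∈ matchedList P i L ↔ r ∈ L ∧ P r i := by
  simp [matchedList]

/-- The contents of the buffer if the neighbours in `L` have been visited. -/
noncomputable def foundBits (P : ι → Bits N → Prop) (nb : ι → Bits N → Bits N) (i : Bits N)
    (L : List ι) (k : ℕ) : Bits N :=
  if h : k < (matchedList P i L).length then nb (matchedList P i L)[k] i else fun _ => false

theorem matchedList_append (i : Bits N) (L L' : List ι) :
    matchedList P i (L ++ L') = matchedList P i L ++ matchedList P i L' := by
  simp [matchedList]

/-- Invariant over prefixes: the counter holds the number of matches so far, and the flag says that
match number k has been passed. The counter may wrap around only after the last match, so every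
comparison that counts is between numbers below 2^N. -/
theorem foldl_forwardStep (i : Bits N) {k : ℕ} (hk : k < 2 ^ N) (L : List ι)
    (hL : (matchedList P i L).length ≤ 2 ^ N) :
    L.foldl (fun x r => forwardStep P nb r x)
        (listState i false (natBits N k) (fun _ => false) (natBits N 0) fun _ => false) =
      listState i (decide (k < (matchedList P i L).length)) (natBits N k)
        (foundBits P nb i L k) (natBits N (matchedList P i L).length) fun _ => false := by
  induction L using List.reverseRecOn with
  | nil => simp [matchedList, foundBits]
  | append_singleton L r ih =>
    rw [matchedList_append, List.length_append] at hL
    rw [List.foldl_append, ih (by omega), List.foldl_cons, List.foldl_nil, forwardStep_listState,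
      increment_natBits]
    by_cases hr : P r i
    · have hm : matchedList P i [r] = [r] := by simp [matchedList, hr]
      rw [hm, List.length_singleton] at hL
      have hiff : natBits N (matchedList P i L).length = natBits N k ↔
          (matchedList P i L).length = k :=
        ⟨natBits_injOn (by omega) hk, fun h => by rw [h]⟩
      have hlen : (matchedList P i (L ++ [r])).length = (matchedList P i L).length + 1 := by
        rw [matchedList_append, hm, List.length_append, List.length_singleton]
      rw [if_pos hr, hlen]
      congr 1
      · simp only [hr, true_and, hiff]
        by_cases h1 : k < (matchedList P i L).length <;>
          by_cases h2 : (matchedList P i L).length = k <;> simp [h1, h2] <;> omega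
      · funext q
        simp only [hr, true_and, hiff, foundBits, matchedList_append, hm, List.length_append,
          List.length_singleton]
        rcases lt_trichotomy k (matchedList P i L).length with h | h | h
        · rw [dif_pos h, dif_pos (by omega), List.getElem_append_left h]
          simp [h.ne']
        · rw [dif_neg (by omega), dif_pos (by omega), List.getElem_append_right (by omega)]
          simp [h]
        · rw [dif_neg (by omega), dif_neg (by omega)]
          simp [h.ne]
    · have hm : matchedList P i (L ++ [r]) = matchedList P i L := by
        simp [matchedList, hr]
      rw [if_neg hr]
      simp [hr, hm, foundBits]

/-- Here L is still to be visited, from its end, and L' is done. When a neighbour was found, the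
index is already erased precisely if match number k lies in L', that is, if L has at most k matches.
-/
theorem foldl_backwardStep (i : Bits N) (k : ℕ) (f : Bool) (o : Bits N) (L L' : List ι)
    (hL : (L ++ L').Nodup)
    (hinj : ∀ r ∈ L ++ L', ∀ r' ∈ L ++ L', P r i → P r' i → nb r i = nb r' i → r = r')
    (hf : f = decide (k < (matchedList P i (L ++ L')).length))
    (ho : o = foundBits P nb i (L ++ L') k) :
    L.reverse.foldl (fun x r => backwardStep P nb r x)
        (listState i f (if f = true ∧ (matchedList P i L).length ≤ k then fun _ => false
          else natBits N k) o (natBits N (matchedList P i L).length) fun _ => false) =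
      listState i f (if f = true then fun _ => false else natBits N k) o (natBits N 0)
        fun _ => false := by
  induction L using List.reverseRecOn generalizing L' with
  | nil => simp [matchedList]
  | append_singleton L r ih =>
    rw [List.append_assoc] at hL hinj hf ho
    rw [← ih ([r] ++ L') hL hinj hf ho, List.reverse_append, List.reverse_singleton,
      List.singleton_append, List.foldl_cons]
    congr 1
    have hinc : natBits N (matchedList P i (L ++ [r])).length =
        increment (P r i) (natBits N (matchedList P i L).length) := by
      rw [increment_natBits, matchedList_append, List.length_append]
      by_cases hr : P r i <;> simp [matchedList, hr]
    rw [hinc, backwardStep_listState]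
    congr 1
    by_cases hr : P r i
    · have hm : matchedList P i [r] = [r] := by simp [matchedList, hr]
      have hlen : (matchedList P i (L ++ [r])).length = (matchedList P i L).length + 1 := by
        rw [matchedList_append, hm, List.length_append, List.length_singleton]
      set a := (matchedList P i L).length with ha
      have hML : matchedList P i (L ++ ([r] ++ L')) =
          matchedList P i L ++ (r :: matchedList P i L') := by
        rw [matchedList_append, matchedList_append, hm, List.singleton_append]
      have hnd : (matchedList P i (L ++ ([r] ++ L'))).Nodup := hL.filter _
      -- Distinct matches have distinct neighbours, so the content of the buffer identifies match
      -- number k. At that moment the counter is a = k, and adding it cancels the index.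
      have hiff : (f = true ∧ nb r i = o) ↔ k = a := by
        have hlt : a < (matchedList P i (L ++ ([r] ++ L'))).length := by
          rw [hML, List.length_append, List.length_cons]
          omega
        have hra : (matchedList P i (L ++ ([r] ++ L')))[a] = r := by
          simp only [hML]
          rw [List.getElem_append_right (by omega)]
          simp [ha]
        rw [hf, decide_eq_true_eq, ho, foundBits]
        constructor
        · rintro ⟨hk, hnb⟩
          rw [dif_pos hk] at hnb
          have hmem := List.getElem_mem hk
          rw [mem_matchedList] at hmem
          have h1 := hinj r (by simp) _ hmem.1 hr hmem.2 hnb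
          exact ((hnd.getElem_inj_iff).1 (hra.trans h1)).symm
        · rintro rfl
          refine ⟨hlt, ?_⟩
          rw [dif_pos hlt, hra]
      funext q
      simp only [hr, true_and, hiff, hlen]
      by_cases hka : k = a
      · have hf' : f = true := (hiff.2 hka).1
        simp [hf', hka]
      · have : a + 1 ≤ k ↔ a ≤ k := by omega
        simp [hka, this]
    · have hm : matchedList P i (L ++ [r]) = matchedList P i L := by
        simp [matchedList, hr]
      funext q
      simp [hr, hm]

/-- The adjacency list function: the neighbours in the order of the list. -/
noncomputable def adjacencyList (L : List ι) (P : ι → Bits N → Prop) (nb : ι → Bits N → Bits N)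
    (s : ℕ) (i : Bits N) (k : Fin s) : Bool × Bits N :=
  if h : (k : ℕ) < (matchedList P i L).length then (false, nb (matchedList P i L)[(k : ℕ)] i)
  else (true, natBits N k)

theorem NeighborPrograms.isAdjacencyList (h : NeighborPrograms H L P nb val G) {s : ℕ}
    (hs : s ≤ 2 ^ N) (hLs : ∀ i, (matchedList P i L).length ≤ s) :
    IsAdjacencyList H (adjacencyList L P nb s) where
  injective i k k' hkk' := by
    have hnd : (matchedList P i L).Nodup := h.nodup.filter _
    have hmem : ∀ k (hk : k < (matchedList P i L).length),
        (matchedList P i L)[k] ∈ L ∧ P (matchedList P i L)[k] i := by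
      intro k hk
      have hmem := List.getElem_mem hk
      rwa [mem_matchedList] at hmem
    intro heq
    rw [adjacencyList, adjacencyList] at heq
    split_ifs at heq with h1 h2 h2
    · simp only [Prod.mk.injEq, true_and] at heq
      exact hkk' (Fin.ext ((hnd.getElem_inj_iff).1 (h.injective i _ (hmem _ h1).1 _ (hmem _ h2).1
        (hmem _ h1).2 (hmem _ h2).2 heq)))
    · simp at heq
    · simp at heq
    · simp only [Prod.mk.injEq, true_and] at heq
      exact hkk' (Fin.ext (natBits_injOn (k.2.trans_le hs) (k'.2.trans_le hs) heq))
  covers i j hij := by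
    obtain ⟨r, hr, hP, hnb⟩ := h.exists_of_ne_zero i j hij
    have hnd : (matchedList P i L).Nodup := h.nodup.filter _
    have hrm : r ∈ matchedList P i L := by
      rw [mem_matchedList]
      exact ⟨hr, hP⟩
    obtain ⟨k, hk, rfl⟩ := List.mem_iff_getElem.1 hrm
    refine ⟨⟨k, hk.trans_le (hLs i)⟩, by simp [adjacencyList, hk, hnb], ?_⟩
    intro k' hk'
    rw [adjacencyList] at hk'
    split_ifs at hk' with h1
    · simp only [Prod.mk.injEq, true_and] at hk'
      have hmem := List.getElem_mem h1
      rw [mem_matchedList] at hmem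
      exact Fin.ext ((hnd.getElem_inj_iff).1
        (h.injective i _ hmem.1 _ hr hmem.2 hP (hk'.trans hnb.symm)))
    · simp at hk'
  dummy i k k' hk := by
    rw [adjacencyList] at hk
    split_ifs at hk with h1
    · simp at hk
    · simp only [Prod.mk.injEq, true_and] at hk
      exact hk.symm

theorem NeighborPrograms.listOracle_apply (h : NeighborPrograms H L P nb val G) {s : ℕ}
    (hs : s ≤ 2 ^ N) (hLs : ∀ i, (matchedList P i L).length ≤ s) (i : Bits N) (k : Fin s) :
    finalStep N (L.reverse.foldl (fun x r => backwardStep P nb r x)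
      (L.foldl (fun x r => forwardStep P nb r x)
        (listState i false (natBits N k) (fun _ => false) (fun _ => false) fun _ => false))) =
    listState i (adjacencyList L P nb s i k).1 (adjacencyList L P nb s i k).2 (fun _ => false)
      (fun _ => false) fun _ => false := by
  have h0 : natBits N 0 = fun _ => false := by
    funext q
    simp [natBits]
  have hf := foldl_forwardStep (P := P) (nb := nb) i (k.2.trans_le hs) L ((hLs i).trans hs)
  rw [h0] at hf
  have hb := foldl_backwardStep (P := P) (nb := nb) i k
    (decide ((k : ℕ) < (matchedList P i L).length)) (foundBits P nb i L k) L []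
    (by simpa using h.nodup) (by simpa using h.injective i) (by simp) (by simp)
  -- At the start of the second loop the index is intact: a raised flag means that k is less than
  -- the full number of matches.
  rw [h0, if_neg (by rw [decide_eq_true_eq]; omega)] at hb
  rw [hf, hb]
  by_cases hk : (k : ℕ) < (matchedList P i L).length
  · simp only [hk, decide_true, if_true, finalStep_listState_true, adjacencyList, foundBits,
      dif_pos]
  · simp [hk, adjacencyList, foundBits, finalStep_listState_false]

end Loops

end ListOracle

section ListOracle

variable {N : ℕ} {ι : Type} {H : Matrix (Bits N) (Bits N) ℝ} {L : List ι}
  {P : ι → Bits N → Prop} {nb : ι → Bits N → Bits N} {val : ι → ℝ} {G : ℕ}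

/-! ### Cost of the adjacency list oracle -/

/-- The predicates that read a bit which is not a target. -/
def bitsOffRange {V : Type} {m : ℕ} (w : Fin m → V) : Set ((V → Bool) → Prop) :=
  {f | ∃ v, (∀ p, w p ≠ v) ∧ f = fun x => x v = true}

theorem NeighborPrograms.program_row (h : NeighborPrograms H L P nb val G) {r : ι} (hr : r ∈ L)
    {m : ℕ} (w : Fin m → ListRegister N) (hw : ∀ p q, w p ≠ rowWire q) :
    HasProgram (bitsOffRange w) ({fun x => P r (fun q => x (rowWire q))} ∪
      {f | ∃ q, f = fun x => nb r (fun q => x (rowWire q)) q = true}) G :=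
  h.program r hr (ListRegister N → Bool) (bitsOffRange w) (fun x q => x (rowWire q))
    fun q => ⟨_, fun p => hw p q, rfl⟩

theorem NeighborPrograms.program_isHit (h : NeighborPrograms H L P nb val G) {r : ι}
    (hr : r ∈ L) {m : ℕ} (w : Fin m → ListRegister N) (hw : ∀ p q, w p ≠ rowWire q)
    (hw' : ∀ p q, w p ≠ counterWire q) (hw'' : ∀ p q, w p ≠ indexWire q) :
    HasProgram (bitsOffRange w) (({fun x => P r (fun q => x (rowWire q))} ∪
      {f | ∃ q, f = fun x => nb r (fun q => x (rowWire q)) q = true}) ∪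
        {fun x => IsHit P r x}) (G + (8 * N + 2)) :=
  (h.program_row hr w hw).trans (((HasProgram.of_mem (.inr (.inl rfl))).and
    (HasProgram.eq_bits (fun q => .of_mem (.inl ⟨_, fun p => hw' p q, rfl⟩))
      fun q => .of_mem (.inl ⟨_, fun p => hw'' p q, rfl⟩))).mono subset_rfl subset_rfl (by omega))

/-- One common bound on ancillas and gates is used for all elementary maps of the loops, so that
they share their ancillas and costs are found by counting maps. -/
theorem NeighborPrograms.revImpl_copyNeighbor (h : NeighborPrograms H L P nb val G) {r : ι}
    (hr : r ∈ L) : RevImpl (G + 20 * N + 20) (4 * (G + 20 * N + 20) + N + 1)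
      (copyNeighbor P nb r) := by
  refine (RevImpl.xorInto (fun p q hpq => ?_) (((h.program_isHit hr bufferWire (by
    simp [bufferWire, rowWire]) (by simp [bufferWire, counterWire]) (by
    simp [bufferWire, indexWire])).comp (HasProgram.iUnion_fin (g := 1) fun q => ?_)).mono
    subset_rfl subset_rfl (g' := G + 20 * N + 20) (by omega)) le_rfl).mono (by omega)
  · exact Sum.inl_injective (Sum.inr_injective hpq)
  · exact (HasProgram.of_mem (.inr (.inr rfl))).and (HasProgram.of_mem (.inr (.inl (.inr ⟨q, rfl⟩))))

theorem NeighborPrograms.revImpl_flagNeighbor (h : NeighborPrograms H L P nb val G) {r : ι}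
    (hr : r ∈ L) : RevImpl (G + 20 * N + 20) (4 * (G + 20 * N + 20) + N + 1)
      (flagNeighbor P r) := by
  refine (RevImpl.xorInto (fun p q _ => Subsingleton.elim p q) ((h.program_isHit hr (flagWire N)
    (by simp [flagWire, rowWire]) (by simp [flagWire, counterWire]) (by
    simp [flagWire, indexWire])).mono subset_rfl ?_ (g' := G + 20 * N + 20) (by omega))
    le_rfl).mono (by omega)
  rintro f ⟨p, rfl⟩
  exact .inr rfl

theorem NeighborPrograms.revImpl_carryNeighbor (h : NeighborPrograms H L P nb val G) {r : ι}
    (hr : r ∈ L) : RevImpl (G + 20 * N + 20) (4 * (G + 20 * N + 20) + N + 1)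
      (carryNeighbor P r) := by
  refine (RevImpl.xorInto (fun p q hpq => ?_) (((h.program_row hr carryWire (by
    simp [carryWire, rowWire])).comp ((HasProgram.of_mem (.inr (.inl rfl))).initial_fin
      fun q => .inl ⟨counterWire q, by simp [carryWire, counterWire], rfl⟩)).mono
    subset_rfl subset_rfl (g' := G + 20 * N + 20) (by omega)) le_rfl).mono (by omega)
  exact Sum.inr_injective (Sum.inr_injective (Sum.inr_injective hpq))

theorem NeighborPrograms.revImpl_borrowNeighbor (h : NeighborPrograms H L P nb val G) {r : ι}
    (hr : r ∈ L) : RevImpl (G + 20 * N + 20) (4 * (G + 20 * N + 20) + N + 1)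
      (borrowNeighbor P r) := by
  refine (RevImpl.xorInto (fun p q hpq => ?_) (((h.program_row hr carryWire (by
    simp [carryWire, rowWire])).comp ((HasProgram.iUnion_fin (g := 1)
      (F := fun (q : Fin N) x => ¬x (counterWire q) = true) fun q => ?_).comp
      ((HasProgram.of_mem (.inl (.inr (.inl rfl)))).initial_fin
        fun q => .inr ⟨q, rfl⟩))).mono
    subset_rfl subset_rfl (g' := G + 20 * N + 20) (by omega)) le_rfl).mono (by omega)
  · exact Sum.inr_injective (Sum.inr_injective (Sum.inr_injective hpq))
  · exact (HasProgram.of_mem (.inl ⟨counterWire q, by simp [carryWire, counterWire], rfl⟩)).not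

theorem revImpl_addCarry (a : ℕ) : RevImpl a (4 * a + N + 1) (addCarry N) := by
  refine (RevImpl.xorInto (g := 0) (fun p q hpq => ?_) (.of_subset ?_) (by omega)).mono (by omega)
  · exact Sum.inl_injective (Sum.inr_injective (Sum.inr_injective hpq))
  · rintro f ⟨q, rfl⟩
    exact ⟨carryWire q, by simp [carryWire, counterWire], rfl⟩

theorem NeighborPrograms.revImpl_eraseIndex (h : NeighborPrograms H L P nb val G) {r : ι}
    (hr : r ∈ L) : RevImpl (G + 20 * N + 20) (4 * (G + 20 * N + 20) + N + 1)
      (eraseIndex P nb r) := by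
  refine (RevImpl.xorInto (fun p q hpq => ?_) (((h.program_row hr indexWire (by
    simp [indexWire, rowWire])).comp ((((HasProgram.of_mem (.inr (.inl rfl))).and
      (.of_mem (.inl ⟨flagWire N 0, by simp [flagWire, indexWire], rfl⟩))).and
      (HasProgram.eq_bits (fun q => .of_mem (.inr (.inr ⟨q, rfl⟩)))
        fun q => .of_mem (.inl ⟨bufferWire q, by simp [bufferWire, indexWire], rfl⟩))).comp
      (HasProgram.iUnion_fin (g := 1) fun q => (HasProgram.of_mem (.inr rfl)).and
        (.of_mem (.inl (.inl ⟨counterWire q, by simp [counterWire, indexWire], rfl⟩)))))).mono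
    subset_rfl subset_rfl (g' := G + 20 * N + 20) (by omega)) le_rfl).mono (by omega)
  exact Sum.inr_injective (Sum.inr_injective (Sum.inl_injective hpq))

theorem revImpl_finalStep {a : ℕ} (ha : 2 * N + 1 ≤ a) :
    RevImpl a (3 * (4 * a + N + 1)) (finalStep N) := by
  have h1 : RevImpl a (4 * a + N + 1)
      (xorInto (flagWire N) fun _ _ => True) := by
    refine (RevImpl.xorInto (g := 1) (fun p q _ => Subsingleton.elim p q)
      (HasProgram.const_true.mono subset_rfl ?_ le_rfl) (by omega)).mono (by omega)
    rintro f ⟨q, rfl⟩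
    rfl
  have h2 : RevImpl a (4 * a + N + 1)
      (xorInto indexWire fun q (x : ListRegister N → Bool) => x (bufferWire q) = true) := by
    refine (RevImpl.xorInto (g := 0) (fun p q hpq => ?_) (.of_subset ?_) (by omega)).mono
      (by omega)
    · exact Sum.inr_injective (Sum.inr_injective (Sum.inl_injective hpq))
    · rintro f ⟨q, rfl⟩
      exact ⟨bufferWire q, by simp [bufferWire, indexWire], rfl⟩
  have h3 : RevImpl a (4 * a + N + 1)
      (xorInto bufferWire fun q (x : ListRegister N → Bool) =>
        ¬x (flagWire N 0) = true ∧ x (indexWire q) = true) := by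
    refine (RevImpl.xorInto (g := N * 2) (fun p q hpq => ?_)
      (HasProgram.iUnion_fin fun q => HasProgram.and (g := 1) (g' := 0)
        (HasProgram.not (g := 0) (.of_mem ?_)) (.of_mem ?_)) (by omega)).mono (by omega)
    · exact Sum.inl_injective (Sum.inr_injective hpq)
    · exact ⟨flagWire N 0, by simp [flagWire, bufferWire], rfl⟩
    · exact ⟨indexWire q, by simp [bufferWire, indexWire], rfl⟩
  exact (h3.comp (h2.comp h1)).mono (by omega)

theorem NeighborPrograms.hasOF (h : NeighborPrograms H L P nb val G) {s : ℕ} (hs : s ≤ 2 ^ N)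
    (hLs : ∀ i, (matchedList P i L).length ≤ s) :
    HasOF H s (5 * ((9 * L.length + 3) * (4 * (G + 20 * N + 20) + N + 1)) : ℕ)
      (5 * N + 1 + (G + 20 * N + 20) : ℕ) := by
  set g := 4 * (G + 20 * N + 20) + N + 1 with hg
  have hf : ∀ r ∈ L, RevImpl (G + 20 * N + 20) (5 * g) (forwardStep P nb r) := fun r hr =>
    ((h.revImpl_borrowNeighbor hr).comp ((revImpl_addCarry _).comp
      ((h.revImpl_carryNeighbor hr).comp ((h.revImpl_flagNeighbor hr).comp
        (h.revImpl_copyNeighbor hr))))).mono (by omega)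
  have hb : ∀ r ∈ L.reverse, RevImpl (G + 20 * N + 20) (4 * g) (backwardStep P nb r) := by
    intro r hr
    rw [List.mem_reverse] at hr
    exact ((h.revImpl_eraseIndex hr).comp ((h.revImpl_carryNeighbor hr).comp
      ((revImpl_addCarry _).comp (h.revImpl_borrowNeighbor hr)))).mono (by omega)
  -- Per element of the list there are 5 elementary maps forwards and 4 backwards, and 3 at the end:
  -- this is the factor 9 |L| + 3.
  have htot := (revImpl_finalStep (N := N) (a := G + 20 * N + 20) (by omega)).comp
    ((RevImpl.foldl L.reverse hb).comp (RevImpl.foldl L hf))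
  obtain ⟨C, hC, hCx⟩ := htot.exists_circuit_ancillas
  refine ⟨_, C, ⟨_, h.isAdjacencyList hs hLs, fun i k => hCx _ _ ?_⟩, ?_, ?_⟩
  · have hl : ∀ (f : Bool) (K : Bits N), (Sum.elim (Sum.elim i (Sum.elim (fun _ => f) K))
        fun _ => false : ListRegister N → Bool) =
        listState i f K (fun _ => false) (fun _ => false) fun _ => false := by
      intro f K
      funext v
      rcases v with v | v | v | v <;> rfl
    rw [hl, hl]
    exact h.listOracle_apply hs hLs i k
  · rw [Nat.cast_le]
    refine hC.trans (le_of_eq ?_)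
    rw [List.length_reverse, ← hg]
    ring
  · rw [Nat.cast_le]
    simp only [Fintype.card_sum, Fintype.card_fin]
    omega

end ListOracle

/-! ## The Kikuchi Hamiltonian -/

section Hamiltonian

variable {n k ℓ : ℕ}

/-- The sum of the signs of the constraints with scope `S`. -/
def scopeWeight (I : XORInstance n k) (S : KSubset n k) : ℤ :=
  (I.map fun c => if c.1 = S then (c.2 : ℤ) else 0).sum

/-- The scopes of nonzero weight. -/
def activeScopes (I : XORInstance n k) : Finset (KSubset n k) :=
  Finset.univ.filter fun S => scopeWeight I S ≠ 0

theorem card_activeScopes_le (I : XORInstance n k) :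
    (activeScopes I).card ≤ Multiset.card I := by
  have h : activeScopes I ⊆ (I.map Prod.fst).toFinset := by
    intro S hS
    rw [activeScopes, Finset.mem_filter] at hS
    rw [Multiset.mem_toFinset]
    by_contra hS'
    refine hS.2 (Multiset.sum_eq_zero ?_)
    intro x hx
    obtain ⟨c, hc, rfl⟩ := Multiset.mem_map.1 hx
    rw [if_neg]
    rintro rfl
    exact hS' (Multiset.mem_map_of_mem _ hc)
  refine (Finset.card_le_card h).trans ((Multiset.toFinset_card_le _).trans ?_)
  rw [Multiset.card_map]

theorem kikuchiMatrix_apply (I : XORInstance n k) (T U : KSubset n ℓ) :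
    kikuchiMatrix ℓ I T U =
      (I.map fun c => if T.1 ∆ U.1 = c.1.1 then (c.2 : ℤ) else 0).sum := by
  induction I using Multiset.induction_on with
  | empty => simp [kikuchiMatrix]
  | cons c I ih =>
    simp only [kikuchiMatrix, Multiset.map_cons, Multiset.sum_cons, Matrix.add_apply] at ih ⊢
    rw [ih]
    simp [kikuchiMatching]

theorem kikuchiMatrix_eq_scopeWeight (I : XORInstance n k) {T U : KSubset n ℓ} {S : KSubset n k}
    (h : T.1 ∆ U.1 = S.1) : kikuchiMatrix ℓ I T U = scopeWeight I S := by
  rw [kikuchiMatrix_apply, scopeWeight]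
  congr 1
  refine Multiset.map_congr rfl fun c _ => ?_
  simp only [h, Subtype.coe_inj, eq_comm]

theorem exists_activeScope (I : XORInstance n k) {T U : KSubset n ℓ}
    (h : kikuchiMatrix ℓ I T U ≠ 0) : ∃ S ∈ activeScopes I, T.1 ∆ U.1 = S.1 := by
  by_cases hc : ∃ c ∈ I, T.1 ∆ U.1 = c.1.1
  · obtain ⟨c, -, hc⟩ := hc
    refine ⟨c.1, ?_, hc⟩
    rw [activeScopes, Finset.mem_filter, ← kikuchiMatrix_eq_scopeWeight I hc]
    exact ⟨Finset.mem_univ _, h⟩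
  · refine absurd ?_ h
    rw [kikuchiMatrix_apply]
    refine Multiset.sum_eq_zero fun x hx => ?_
    obtain ⟨c, hcI, rfl⟩ := Multiset.mem_map.1 hx
    exact if_neg fun h => hc ⟨c, hcI, h⟩

theorem kikuchiHamiltonian_encodeSet (I : XORInstance n k) (Λ : ℝ) (T U : KSubset n ℓ) :
    kikuchiHamiltonian ℓ I Λ (encodeSet T) (encodeSet U) = kikuchiMatrix ℓ I T U / Λ := by
  simp only [kikuchiHamiltonian, Matrix.of_apply, encodeSet_injective.eq_iff]
  rw [Finset.sum_eq_single T, Finset.sum_eq_single U]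
  · simp
  · intro U' _ hU'
    simp [hU']
  · simp
  · intro T' _ hT'
    simp [hT']
  · simp

theorem exists_of_kikuchiHamiltonian_ne_zero (I : XORInstance n k) (Λ : ℝ)
    {x y : Bits (numQubits n ℓ)} (h : kikuchiHamiltonian ℓ I Λ x y ≠ 0) :
    ∃ T U : KSubset n ℓ, encodeSet T = x ∧ encodeSet U = y ∧ kikuchiMatrix ℓ I T U ≠ 0 := by
  by_contra hne
  refine h ?_
  rw [kikuchiHamiltonian, Matrix.of_apply]
  refine Finset.sum_eq_zero fun T _ => Finset.sum_eq_zero fun U _ => ?_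
  split_ifs with hTU
  · by_cases h0 : kikuchiMatrix ℓ I T U = 0
    · simp [h0]
    · exact absurd ⟨T, U, hTU.1, hTU.2, h0⟩ hne
  · rfl

theorem symmDiff_eq_iff {α : Type} [DecidableEq α] (T U S : Finset α) :
    T ∆ U = S ↔ T ∆ S = U := by
  constructor <;> rintro rfl <;> simp

theorem exists_of_isMatched (hℓ : 0 < ℓ) {S : KSubset n k} {i : Bits (numQubits n ℓ)}
    (h : IsMatched S i) : ∃ T U : KSubset n ℓ, encodeSet T = i ∧ T.1 ∆ U.1 = S.1 ∧
      neighbor S i = encodeSet U := by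
  obtain ⟨T, rfl⟩ := h.1
  rw [isMatched_encodeSet_iff hℓ] at h
  exact ⟨T, ⟨_, h⟩, rfl, (symmDiff_eq_iff _ _ _).2 rfl, neighbor_encodeSet rfl⟩

/-- In T ∆ U = S any two sets determine the third: S and T give the neighbour, while T and U give
back S. Merging constraints with equal scope is what makes distinct list elements yield distinct
neighbours. -/
theorem neighborPrograms_kikuchi (hk : 0 < k) (hkℓ : k ≤ 2 * ℓ) (hn : 2 ≤ n)
    (I : XORInstance n k) (Λ : ℝ) :
    NeighborPrograms (kikuchiHamiltonian ℓ I Λ) (activeScopes I).toList IsMatched neighbor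
      (fun S => scopeWeight I S / Λ) (640 * (k + 1) * numQubits n ℓ) where
  nodup := Finset.nodup_toList _
  apply_eq S _ i h := by
    obtain ⟨T, U, rfl, hTU, hnb⟩ := exists_of_isMatched (by omega) h
    rw [hnb, kikuchiHamiltonian_encodeSet, kikuchiMatrix_eq_scopeWeight I hTU]
  exists_of_ne_zero i j h := by
    obtain ⟨T, U, rfl, rfl, hK⟩ := exists_of_kikuchiHamiltonian_ne_zero I Λ h
    obtain ⟨S, hS, hTU⟩ := exists_activeScope I hK
    have hTS := (symmDiff_eq_iff _ _ _).1 hTU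
    refine ⟨S, Finset.mem_toList.2 hS, ?_, neighbor_encodeSet hTS⟩
    rw [isMatched_encodeSet_iff (by omega), hTS, U.2]
  injective i S _ S' _ h h' hSS' := by
    obtain ⟨T, U, rfl, hTU, hnb⟩ := exists_of_isMatched (by omega) h
    obtain ⟨T', U', hT', hTU', hnb'⟩ := exists_of_isMatched (by omega) h'
    obtain rfl := encodeSet_injective hT'
    rw [hnb, hnb'] at hSS'
    obtain rfl := encodeSet_injective hSS'
    exact Subtype.ext (hTU.symm.trans hTU')
  program S _ X B i hi := HasProgram.neighbor i hi hk hkℓ hn S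

/-- The map S ↦ T ∆ S injects the matched scopes into the nonzero entries of row T; scopes of zero
weight had to be dropped for this. -/
theorem length_matchedList_le (hℓ : 0 < ℓ) (I : XORInstance n k) {s : ℕ}
    (hs : IsSparse s (kikuchiMatrix ℓ I)) (i : Bits (numQubits n ℓ)) :
    (matchedList IsMatched i (activeScopes I).toList).length ≤ s := by
  classical
  set M := matchedList IsMatched i (activeScopes I).toList with hM
  have hnd : M.Nodup := (Finset.nodup_toList _).filter _
  by_cases hi : IsCode i
  · obtain ⟨T, rfl⟩ := hi
    have hMmem : ∀ S ∈ M, scopeWeight I S ≠ 0 ∧ (T.1 ∆ S.1).card = ℓ := by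
      intro S hS
      rw [hM, mem_matchedList, Finset.mem_toList, activeScopes, Finset.mem_filter,
        isMatched_encodeSet_iff hℓ] at hS
      exact ⟨hS.1.2, hS.2⟩
    rw [← List.toFinset_card_of_nodup hnd]
    refine le_trans ?_ (hs.1 T)
    rw [Set.ncard_eq_toFinset_card']
    refine Finset.card_le_card_of_injOn
      (fun S => if h : (T.1 ∆ S.1).card = ℓ then ⟨T.1 ∆ S.1, h⟩ else T) ?_ ?_
    · intro S hS
      obtain ⟨h1, h2⟩ := hMmem S (by simpa using hS)
      simp only [dif_pos h2, Set.coe_toFinset, Set.mem_ofPred_eq]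
      rw [kikuchiMatrix_eq_scopeWeight I (S := S) (by simp)]
      exact h1
    · intro S hS S' hS' hSS'
      obtain ⟨-, h2⟩ := hMmem S (by simpa using hS)
      obtain ⟨-, h2'⟩ := hMmem S' (by simpa using hS')
      simp only [dif_pos h2, dif_pos h2', Subtype.mk.injEq] at hSS'
      exact Subtype.ext (symmDiff_right_injective _ hSS')
  · have : M = [] := by
      rw [List.eq_nil_iff_forall_not_mem]
      intro S hS
      rw [hM, mem_matchedList] at hS
      exact hi hS.2.1
    simp [this]

end Hamiltonian

/-! ## Tail bounds for planted instances -/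

section Expectation

variable {α γ : Type}

/-- The expectation of a nonnegative function. -/
noncomputable def expect (p : PMF α) (φ : α → ℝ≥0∞) : ℝ≥0∞ := ∑' x, p x * φ x

theorem expect_bind (p : PMF α) (f : α → PMF γ) (φ : γ → ℝ≥0∞) :
    expect (p.bind f) φ = ∑' a, p a * expect (f a) φ := by
  simp only [expect, PMF.bind_apply, ← ENNReal.tsum_mul_right, ← ENNReal.tsum_mul_left]
  rw [ENNReal.tsum_comm]
  simp only [mul_assoc]

theorem expect_pure (a : α) (φ : α → ℝ≥0∞) : expect (PMF.pure a) φ = φ a := by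
  rw [expect, tsum_eq_single a]
  · simp
  · intro b hb
    simp [hb]

theorem expect_map (p : PMF α) (f : α → γ) (φ : γ → ℝ≥0∞) :
    expect (p.map f) φ = expect p (φ ∘ f) := by
  rw [← PMF.bind_pure_comp, expect_bind]
  simp only [Function.comp_apply, expect_pure]
  rfl

theorem expect_const (p : PMF α) (c : ℝ≥0∞) : expect p (fun _ => c) = c := by
  rw [expect, ENNReal.tsum_mul_right, p.tsum_coe, one_mul]

theorem expect_const_mul (p : PMF α) (c : ℝ≥0∞) (φ : α → ℝ≥0∞) :
    expect p (fun x => c * φ x) = c * expect p φ := by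
  rw [expect, expect, ← ENNReal.tsum_mul_left]
  exact tsum_congr fun x => mul_left_comm _ _ _

theorem expect_add (p : PMF α) (φ ψ : α → ℝ≥0∞) :
    expect p (fun x => φ x + ψ x) = expect p φ + expect p ψ := by
  simp only [expect, mul_add, ENNReal.tsum_add]

theorem expect_mono (p : PMF α) {φ ψ : α → ℝ≥0∞} (h : ∀ x, φ x ≤ ψ x) :
    expect p φ ≤ expect p ψ :=
  ENNReal.tsum_le_tsum fun x => mul_le_mul_right (h x) _

theorem toOuterMeasure_le_expect (p : PMF α) {s : Set α} {φ : α → ℝ≥0∞} (h : ∀ x ∈ s, 1 ≤ φ x) :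
    p.toOuterMeasure s ≤ expect p φ := by
  rw [PMF.toOuterMeasure_apply]
  refine ENNReal.tsum_le_tsum fun x => ?_
  by_cases hx : x ∈ s
  · rw [Set.indicator_of_mem hx]
    calc p x = p x * 1 := (mul_one _).symm
      _ ≤ p x * φ x := mul_le_mul_right (h x hx) _
  · simp [hx]

/-- Independence, in the only form needed: the mean of a product of weights factors. -/
theorem expect_iidMultiset (p : PMF α) (w : α → ℝ≥0∞) (t : ℕ) :
    expect (iidMultiset p t) (fun I => (I.map w).prod) = expect p w ^ t := by
  induction t with
  | zero => simp [iidMultiset, expect_pure]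
  | succ t ih =>
    rw [iidMultiset, expect_bind, pow_succ']
    simp only [expect_map, Function.comp_def, Multiset.map_cons, Multiset.prod_cons,
      expect_const_mul, ih]
    simp only [← mul_assoc, ENNReal.tsum_mul_right]
    rfl

theorem tsum_poisson_mul_pow (m : ℝ≥0) {q : ℝ} (hq : 0 ≤ q) :
    ∑' t, (ProbabilityTheory.poissonMeasure m).toPMF t * ENNReal.ofReal q ^ t =
      ENNReal.ofReal (Real.exp (m * (q - 1))) := by
  have hs : HasSum (fun t : ℕ => Real.exp (-m) * ((m * q) ^ t / t.factorial))
      (Real.exp (-m) * Real.exp (m * q)) := by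
    refine HasSum.mul_left _ ?_
    rw [Real.exp_eq_exp_ℝ]
    exact NormedSpace.expSeries_div_hasSum_exp (m * q : ℝ)
  have he : Real.exp (m * (q - 1)) = Real.exp (-m) * Real.exp (m * q) := by
    rw [← Real.exp_add]
    ring_nf
  rw [he, ← hs.tsum_eq, ENNReal.ofReal_tsum_of_nonneg (fun t => by positivity) hs.summable]
  refine tsum_congr fun t => ?_
  rw [MeasureTheory.Measure.toPMF_apply, ProbabilityTheory.poissonMeasure_singleton,
    ← ENNReal.ofReal_pow hq, ← ENNReal.ofReal_mul (by positivity)]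
  congr 1
  rw [mul_pow]
  ring

end Expectation

section Tail

variable {n k : ℕ}

/-- Markov's inequality for e^count. One constraint contributes a mean of at most 1 + 2δ because e -
1 ≤ 2, and the Poisson generating function turns this into e^(2mδ). -/
theorem plantedPoisson_countP_tail (hkn : k ≤ n) (z : Fin n → ℤˣ) (m : ℝ≥0) (ρ : unitInterval)
    (A : XORConstraint n k → Prop) [DecidablePred A] {δ : ℝ} (hδ : 0 ≤ δ)
    (hA : expect (constraintLaw hkn z ρ) (fun c => if A c then 1 else 0) ≤ ENNReal.ofReal δ)
    (s : ℝ) :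
    (plantedPoisson hkn z m ρ).toOuterMeasure {I | s < (I.countP A : ℝ)} ≤
      ENNReal.ofReal (Real.exp (2 * m * δ - s)) := by
  let w : XORConstraint n k → ℝ≥0∞ := fun c => if A c then ENNReal.ofReal (Real.exp 1) else 1
  have hprod : ∀ I : XORInstance n k,
      (I.map w).prod = ENNReal.ofReal (Real.exp (I.countP A)) := by
    intro I
    induction I using Multiset.induction_on with
    | empty => simp
    | cons c I ih =>
      rw [Multiset.map_cons, Multiset.prod_cons, ih, Multiset.countP_cons]
      by_cases hc : A c
      · simp only [w, hc, if_true]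
        rw [← ENNReal.ofReal_mul (by positivity), ← Real.exp_add]
        push_cast
        ring_nf
      · simp [w, hc]
  have hw : expect (constraintLaw hkn z ρ) w ≤ ENNReal.ofReal (1 + 2 * δ) := by
    calc expect (constraintLaw hkn z ρ) w
        ≤ expect (constraintLaw hkn z ρ) (fun c => 1 + 2 * if A c then 1 else 0) := by
          refine expect_mono _ fun c => ?_
          by_cases hc : A c
          · simp only [w, hc, if_true]
            rw [ENNReal.ofReal_le_iff_le_toReal (by norm_num)]
            have := Real.exp_one_lt_d9
            norm_num
            linarith
          · simp [w, hc]
      _ = 1 + 2 * expect (constraintLaw hkn z ρ) (fun c => if A c then 1 else 0) := by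
          rw [expect_add, expect_const, expect_const_mul]
      _ ≤ 1 + 2 * ENNReal.ofReal δ := by gcongr
      _ = ENNReal.ofReal (1 + 2 * δ) := by
          rw [ENNReal.ofReal_add (by norm_num) (by positivity), ENNReal.ofReal_mul (by norm_num)]
          simp
  calc (plantedPoisson hkn z m ρ).toOuterMeasure {I | s < (I.countP A : ℝ)}
      ≤ expect (plantedPoisson hkn z m ρ)
          (fun I => ENNReal.ofReal (Real.exp (-s)) * (I.map w).prod) := by
        refine toOuterMeasure_le_expect _ fun I hI => ?_
        rw [hprod, ← ENNReal.ofReal_mul (by positivity), ← Real.exp_add, ENNReal.one_le_ofReal]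
        refine Real.one_le_exp ?_
        have hI' : s < (I.countP A : ℝ) := hI
        linarith
    _ = ENNReal.ofReal (Real.exp (-s)) * ∑' t, (ProbabilityTheory.poissonMeasure m).toPMF t *
          expect (constraintLaw hkn z ρ) w ^ t := by
        rw [expect_const_mul, plantedPoisson, expect_bind]
        simp only [planted, expect_iidMultiset]
    _ ≤ ENNReal.ofReal (Real.exp (-s)) * ∑' t, (ProbabilityTheory.poissonMeasure m).toPMF t *
          ENNReal.ofReal (1 + 2 * δ) ^ t := by
        gcongr
    _ = ENNReal.ofReal (Real.exp (2 * m * δ - s)) := by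
        rw [tsum_poisson_mul_pow _ (by positivity), ← ENNReal.ofReal_mul (by positivity),
          ← Real.exp_add]
        ring_nf

/-! ### The probability that a scope matches a given set -/

/-- After multiplication by k!, compare factor by factor: n (k - i) ≤ k (n - i). -/
theorem pow_le_pow_mul_choose {n k : ℕ} (hkn : k ≤ n) : n ^ k ≤ k ^ k * n.choose k := by
  have hpow : ∀ a : ℕ, a ^ k = ∏ _i ∈ Finset.range k, a := by simp
  have h : n ^ k * k.factorial ≤ k ^ k * n.descFactorial k := by
    rw [← Nat.descFactorial_self, Nat.descFactorial_eq_prod_range, Nat.descFactorial_eq_prod_range,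
      hpow n, hpow k, ← Finset.prod_mul_distrib, ← Finset.prod_mul_distrib]
    refine Finset.prod_le_prod' fun i hi => ?_
    have hik := Finset.mem_range.1 hi
    obtain ⟨a, rfl⟩ := Nat.exists_eq_add_of_le hik.le
    obtain ⟨b, rfl⟩ := Nat.exists_eq_add_of_le hkn
    rw [Nat.add_sub_cancel_left, add_assoc, Nat.add_sub_cancel_left]
    nlinarith [Nat.zero_le (i * b)]
  rw [Nat.descFactorial_eq_factorial_mul_choose] at h
  exact Nat.le_of_mul_le_mul_right (by linarith) k.factorial_pos

theorem expect_constraintLaw_fst (hkn : k ≤ n) (z : Fin n → ℤˣ) (ρ : unitInterval)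
    (φ : KSubset n k → ℝ≥0∞) :
    expect (constraintLaw hkn z ρ) (fun c => φ c.1) = expect (scopeLaw hkn) φ := by
  rw [constraintLaw, expect_bind]
  simp only [expect_map, Function.comp_def, expect_const]
  rfl

/-- If |T ∆ S| = |T|, then S has as many elements inside T as outside, namely h each, and S is
recovered from these two parts. -/
theorem card_matching_scopes_le {ℓ h : ℕ} (hk : k = 2 * h) (T : KSubset n ℓ) :
    (Finset.univ.filter fun S : KSubset n k => (T.1 ∆ S.1).card = ℓ).card ≤ ℓ ^ h * n ^ h := by
  have hinj : (Finset.univ.filter fun S : KSubset n k => (T.1 ∆ S.1).card = ℓ).card ≤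
      (Finset.powersetCard h T.1 ×ˢ
        Finset.powersetCard h (Finset.univ : Finset (Fin n))).card := by
    refine Finset.card_le_card_of_injOn (fun S => (S.1 ∩ T.1, S.1 \ T.1)) ?_ ?_
    · intro S hS
      simp only [Finset.coe_filter, Finset.mem_univ, true_and, Set.mem_ofPred_eq] at hS
      have h1 := Finset.card_inter_add_card_sdiff S.1 T.1
      have h2 := Finset.card_inter_add_card_sdiff T.1 S.1
      have h3 : (T.1 ∆ S.1).card = (T.1 \ S.1).card + (S.1 \ T.1).card :=
        Finset.card_union_of_disjoint disjoint_sdiff_sdiff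
      rw [Finset.inter_comm] at h2
      rw [S.2] at h1
      rw [T.2] at h2
      simp only [Finset.coe_product, Set.mem_prod, Finset.mem_coe, Finset.mem_powersetCard]
      exact ⟨⟨Finset.inter_subset_right, by omega⟩, Finset.subset_univ _, by omega⟩
    · intro S _ S' _ hSS'
      simp only [Prod.mk.injEq] at hSS'
      apply Subtype.ext
      rw [← Finset.sdiff_union_inter S.1 T.1, hSS'.1, hSS'.2, Finset.sdiff_union_inter]
  refine hinj.trans ?_
  rw [Finset.card_product, Finset.card_powersetCard, Finset.card_powersetCard, T.2,
    Finset.card_univ, Fintype.card_fin]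
  exact Nat.mul_le_mul (Nat.choose_le_pow _ _) (Nat.choose_le_pow _ _)

theorem expect_matching_le {ℓ h : ℕ} (hk : k = 2 * h) (hn : 0 < n) (hkn : k ≤ n)
    (z : Fin n → ℤˣ) (ρ : unitInterval) (T : KSubset n ℓ) :
    expect (constraintLaw hkn z ρ) (fun c => if (T.1 ∆ c.1.1).card = ℓ then 1 else 0) ≤
      ENNReal.ofReal ((k : ℝ) ^ k * ((ℓ : ℝ) / n) ^ h) := by
  rw [expect_constraintLaw_fst hkn z ρ fun S => if (T.1 ∆ S.1).card = ℓ then 1 else 0]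
  have hcard : Fintype.card (KSubset n k) = n.choose k := by
    rw [Fintype.card_finset_len, Fintype.card_fin]
  have hpos : 0 < n.choose k := Nat.choose_pos hkn
  have heq : expect (scopeLaw hkn) (fun S => if (T.1 ∆ S.1).card = ℓ then 1 else 0) =
      ENNReal.ofReal (((Finset.univ.filter fun S : KSubset n k => (T.1 ∆ S.1).card = ℓ).card : ℝ)
        / n.choose k) := by
    rw [expect, tsum_fintype]
    simp only [scopeLaw, PMF.uniformOfFintype_apply, hcard, mul_ite, mul_one, mul_zero]
    rw [← Finset.sum_filter, Finset.sum_const, nsmul_eq_mul, ENNReal.ofReal_div_of_pos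
      (by exact_mod_cast hpos), ENNReal.ofReal_natCast, ENNReal.ofReal_natCast, div_eq_mul_inv]
  rw [heq]
  refine ENNReal.ofReal_le_ofReal ?_
  have hn' : (0 : ℝ) < n := by exact_mod_cast hn
  rw [div_le_iff₀ (by exact_mod_cast hpos)]
  have h1 : ((Finset.univ.filter fun S : KSubset n k => (T.1 ∆ S.1).card = ℓ).card : ℝ) ≤
      (ℓ : ℝ) ^ h * (n : ℝ) ^ h := by exact_mod_cast card_matching_scopes_le hk T
  have h2 : (n : ℝ) ^ k ≤ (k : ℝ) ^ k * n.choose k := by exact_mod_cast pow_le_pow_mul_choose hkn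
  calc _ ≤ (ℓ : ℝ) ^ h * (n : ℝ) ^ h := h1
    _ = ((ℓ : ℝ) / n) ^ h * (n : ℝ) ^ k := by
        rw [hk, two_mul, pow_add, div_pow]
        field_simp
    _ ≤ ((ℓ : ℝ) / n) ^ h * ((k : ℝ) ^ k * n.choose k) := by gcongr
    _ = _ := by ring

/-! ### Sparsity -/

/-- Distinct nonzero columns U give distinct sets T ∆ U, each the scope of some constraint.
Cancellation between signs can only help. -/
theorem ncard_row_le_countP {ℓ : ℕ} (I : XORInstance n k) (T : KSubset n ℓ) :
    {U | kikuchiMatrix ℓ I T U ≠ 0}.ncard ≤ I.countP fun c => (T.1 ∆ c.1.1).card = ℓ := by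
  classical
  rw [Multiset.countP_eq_card_filter, ← Multiset.card_map (fun c : XORConstraint n k => c.1)]
  refine le_trans ?_ (Multiset.toFinset_card_le _)
  rw [Set.ncard_eq_toFinset_card', ← Finset.card_map ⟨fun S : KSubset n k => S.1,
    Subtype.val_injective⟩, ← Finset.card_image_of_injective (s := Set.toFinset _)
    (f := fun U : KSubset n ℓ => T.1 ∆ U.1)
    (fun U U' h => Subtype.ext (symmDiff_right_injective _ h))]
  refine Finset.card_le_card fun R hR => ?_
  obtain ⟨U, hU, rfl⟩ := Finset.mem_image.1 hR
  rw [Set.mem_toFinset, Set.mem_ofPred_eq, kikuchiMatrix_apply] at hU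
  obtain ⟨c, hc, hTU⟩ : ∃ c ∈ I, T.1 ∆ U.1 = c.1.1 := by
    by_contra hne
    refine hU (Multiset.sum_eq_zero fun x hx => ?_)
    obtain ⟨c, hcI, rfl⟩ := Multiset.mem_map.1 hx
    exact if_neg fun h => hne ⟨c, hcI, h⟩
  simp only [Finset.mem_map, Multiset.mem_toFinset, Multiset.mem_map, Multiset.mem_filter,
    Function.Embedding.coeFn_mk]
  exact ⟨c.1, ⟨c, ⟨hc, by rw [← hTU, symmDiff_symmDiff_cancel_left, U.2]⟩, rfl⟩, hTU.symm⟩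

theorem kikuchiMatrix_symm {ℓ : ℕ} (I : XORInstance n k) (T U : KSubset n ℓ) :
    kikuchiMatrix ℓ I T U = kikuchiMatrix ℓ I U T := by
  rw [kikuchiMatrix_apply, kikuchiMatrix_apply, symmDiff_comm]

theorem isGood_of_countP_le {ℓ : ℕ} {m : ℝ≥0} {C : ℝ} (hC : 0 ≤ C * (ℓ * Real.log n))
    {I : XORInstance n k} (hI : (Multiset.card I : ℝ) ≤ C * m)
    (hrow : ∀ T : KSubset n ℓ,
      ((I.countP fun c => (T.1 ∆ c.1.1).card = ℓ : ℕ) : ℝ) ≤ C * (ℓ * Real.log n)) :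
    IsGood ℓ m C I := by
  refine ⟨⟨⌊C * (ℓ * Real.log n)⌋₊, Nat.floor_le hC, ?_⟩, hI⟩
  have h : ∀ T : KSubset n ℓ,
      {U | kikuchiMatrix ℓ I T U ≠ 0}.ncard ≤ ⌊C * (ℓ * Real.log n)⌋₊ :=
    fun T => (ncard_row_le_countP I T).trans (Nat.le_floor (hrow T))
  refine ⟨h, fun U => ?_⟩
  simp only [fun T => kikuchiMatrix_symm I T U]
  exact h U

end Tail

/-! ## Parameters -/

section Parameters

variable {n k ℓ h : ℕ}

theorem log_two_le_mul_log (hn : 2 ≤ n) (hℓ : 0 < ℓ) : Real.log 2 ≤ ℓ * Real.log n := by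
  have h1 : (1 : ℝ) ≤ ℓ := by exact_mod_cast hℓ
  have h2 : Real.log 2 ≤ Real.log n := Real.log_le_log (by norm_num) (by exact_mod_cast hn)
  have h3 : 0 < Real.log 2 := Real.log_pos (by norm_num)
  nlinarith

/-- Since ln n ≥ ln 2 > 1/2, both log₂ n and the 1 lost in rounding up are at most 2 ln n. -/
theorem numQubits_le (hn : 2 ≤ n) : (numQubits n ℓ : ℝ) ≤ 4 * (ℓ * Real.log n) := by
  have h2 : Real.log 2 ≤ Real.log n := Real.log_le_log (by norm_num) (by exact_mod_cast hn)
  have h3 : 1 / 2 < Real.log 2 := by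
    have := Real.log_two_gt_d9
    linarith
  have h4 : (Nat.clog 2 n : ℝ) < Real.logb 2 n + 1 := by
    rw [← Real.natCeil_logb_natCast]
    refine Nat.ceil_lt_add_one (Real.logb_nonneg (by norm_num) ?_)
    exact_mod_cast (by omega : 1 ≤ n)
  have h5 : Real.logb 2 n ≤ 2 * Real.log n := by
    rw [Real.logb, div_le_iff₀ (by linarith)]
    nlinarith
  have h6 : (Nat.clog 2 n : ℝ) ≤ 4 * Real.log n := by linarith
  rw [numQubits]
  push_cast
  nlinarith [(Nat.cast_nonneg ℓ : (0 : ℝ) ≤ ℓ)]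

/-- The exponent (k - 2)/2 is one less than h, so the powers of n/ℓ and ℓ/n cancel up to one factor
ℓ/n, whose denominator cancels the n in m/n. -/
theorem matching_rate_le {A : ℝ} (hA : 0 < A) (hk : k = 2 * h) (hh : 0 < h) (hn : 0 < n)
    (hℓ : 0 < ℓ) {m : ℝ≥0}
    (hm : (m : ℝ) / n ≤ A * ((n : ℝ) / ℓ) ^ (((k : ℝ) - 2) / 2) * Real.log n) :
    m * ((k : ℝ) ^ k * ((ℓ : ℝ) / n) ^ h) ≤ A * (k : ℝ) ^ k * (ℓ * Real.log n) := by
  have hn' : (0 : ℝ) < n := by exact_mod_cast hn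
  have hℓ' : (0 : ℝ) < ℓ := by exact_mod_cast hℓ
  obtain ⟨j, rfl⟩ := Nat.exists_eq_succ_of_ne_zero hh.ne'
  have he : ((k : ℝ) - 2) / 2 = (j : ℕ) := by
    rw [hk]
    push_cast
    ring
  rw [he, Real.rpow_natCast, div_le_iff₀ hn'] at hm
  calc m * ((k : ℝ) ^ k * ((ℓ : ℝ) / n) ^ (j + 1))
      ≤ (A * ((n : ℝ) / ℓ) ^ j * Real.log n * n) * ((k : ℝ) ^ k * ((ℓ : ℝ) / n) ^ (j + 1)) := by
        gcongr
    _ = A * (k : ℝ) ^ k * (ℓ * Real.log n) * (((n : ℝ) / ℓ) ^ j * ((ℓ : ℝ) / n) ^ j) := by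
        rw [pow_succ ((ℓ : ℝ) / n)]
        field_simp
    _ = A * (k : ℝ) ^ k * (ℓ * Real.log n) := by
        rw [← mul_pow, div_mul_div_cancel₀ hℓ'.ne', div_self hn'.ne', one_pow, mul_one]

theorem card_kSubset_le (n ℓ : ℕ) (hn : 0 < n) :
    (Fintype.card (KSubset n ℓ) : ℝ) ≤ Real.exp (ℓ * Real.log n) := by
  have h1 : Fintype.card (KSubset n ℓ) ≤ n ^ ℓ := by
    rw [Fintype.card_finset_len, Fintype.card_fin]
    exact Nat.choose_le_pow _ _
  rw [← Real.log_pow, Real.exp_log (by positivity)]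
  exact_mod_cast h1

theorem plantedPoisson_not_isGood_le {A a : ℝ} (hA : 0 < A) (ha : 0 < a) (hk : k = 2 * h)
    (hh : 0 < h) (hkn : k ≤ n) (hℓ : 0 < ℓ) {m : ℝ≥0}
    (hm : (m : ℝ) / n ≤ A * ((n : ℝ) / ℓ) ^ (((k : ℝ) - 2) / 2) * Real.log n)
    (hma : a * (ℓ * Real.log n) ≤ m) (z : Fin n → ℤˣ) (ρ : unitInterval) :
    (plantedPoisson hkn z m ρ).toOuterMeasure
        {I | ¬IsGood ℓ m (5 + 2 / a + 2 * (A * (k : ℝ) ^ k)) I} ≤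
      ENNReal.ofReal ((n : ℝ) ^ (-(1 * ℓ : ℝ))) := by
  have hn : 2 ≤ n := by omega
  have hlog := log_two_le_mul_log hn hℓ
  have hlog0 : 0 < Real.log 2 := Real.log_pos (by norm_num)
  -- The last term absorbs twice the mean row count, the 5 leaves at least 3 Lg in the exponent for
  -- a row, and 2/a together with m ≥ a Lg leaves at least 2 Lg for the total count.
  set C := 5 + 2 / a + 2 * (A * (k : ℝ) ^ k) with hC
  set Lg := ℓ * Real.log n with hLg
  have hC0 : 0 ≤ C := by positivity
  have hAk : 0 ≤ A * (k : ℝ) ^ k := by positivity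
  have h2a : 0 < 2 / a := by positivity
  set Ω := plantedPoisson hkn z m ρ with hΩ
  have hsub : {I | ¬IsGood ℓ m C I} ⊆ {I : XORInstance n k | C * m < (I.countP fun _ => True : ℕ)} ∪
      ⋃ T : KSubset n ℓ, {I : XORInstance n k |
        C * Lg < (I.countP fun c => (T.1 ∆ c.1.1).card = ℓ : ℕ)} := by
    intro I hI
    by_contra hne
    simp only [Set.mem_union, Set.mem_iUnion, Set.mem_ofPred_eq, not_or, not_exists, not_lt] at hne
    refine hI (isGood_of_countP_le (mul_nonneg hC0 (by linarith)) ?_ hne.2)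
    simpa using hne.1
  have h1 : Ω.toOuterMeasure {I : XORInstance n k | C * m < (I.countP fun _ => True : ℕ)} ≤
      ENNReal.ofReal (Real.exp (-2 * Lg)) := by
    refine (plantedPoisson_countP_tail hkn z m ρ (fun _ => True) zero_le_one ?_ _).trans ?_
    · simp [expect_const]
    · refine ENNReal.ofReal_le_ofReal (Real.exp_le_exp.2 ?_)
      have : 2 / a * (a * Lg) = 2 * Lg := by field_simp
      nlinarith [m.2]
  have h2 : ∀ T : KSubset n ℓ, Ω.toOuterMeasure {I : XORInstance n k |
      C * Lg < (I.countP fun c => (T.1 ∆ c.1.1).card = ℓ : ℕ)} ≤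
      ENNReal.ofReal (Real.exp (-3 * Lg)) := by
    intro T
    refine (plantedPoisson_countP_tail hkn z m ρ _ (by positivity)
      (expect_matching_le hk (by omega) hkn z ρ T) _).trans ?_
    refine ENNReal.ofReal_le_ofReal (Real.exp_le_exp.2 ?_)
    have h3 := matching_rate_le hA hk hh (by omega) hℓ hm
    rw [mul_assoc 2]
    nlinarith
  have h3 : Ω.toOuterMeasure (⋃ T : KSubset n ℓ, {I : XORInstance n k |
        C * Lg < (I.countP fun c => (T.1 ∆ c.1.1).card = ℓ : ℕ)}) ≤
      ENNReal.ofReal (Real.exp (-2 * Lg)) := by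
    refine (MeasureTheory.measure_iUnion_fintype_le _ _).trans ?_
    refine (Finset.sum_le_sum fun T _ => h2 T).trans ?_
    rw [Finset.sum_const, nsmul_eq_mul, Finset.card_univ, ← ENNReal.ofReal_natCast,
      ← ENNReal.ofReal_mul (by positivity)]
    refine ENNReal.ofReal_le_ofReal ?_
    calc (Fintype.card (KSubset n ℓ) : ℝ) * Real.exp (-3 * Lg)
        ≤ Real.exp Lg * Real.exp (-3 * Lg) := by
          gcongr
          exact card_kSubset_le n ℓ (by omega)
      _ = Real.exp (-2 * Lg) := by
          rw [← Real.exp_add]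
          ring_nf
  refine (Ω.toOuterMeasure.mono hsub).trans ((MeasureTheory.measure_union_le _ _).trans
    ((add_le_add h1 h3).trans ?_))
  rw [← ENNReal.ofReal_add (by positivity) (by positivity)]
  refine ENNReal.ofReal_le_ofReal ?_
  have hn' : (0 : ℝ) < n := by exact_mod_cast (by omega : 0 < n)
  have he : (n : ℝ) ^ (-(1 * ℓ : ℝ)) = Real.exp Lg * Real.exp (-2 * Lg) := by
    rw [Real.rpow_def_of_pos hn', ← Real.exp_add]
    congr 1
    rw [hLg]
    ring
  -- Two failure events of probability e^(-2 Lg) each add up to at most e^(-Lg) = n^(-ℓ).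
  have h2e : 2 ≤ Real.exp Lg := by
    rw [← Real.exp_log (by norm_num : (0 : ℝ) < 2)]
    exact Real.exp_le_exp.2 hlog
  rw [he]
  nlinarith [Real.exp_pos (-2 * Lg)]

/-! ### Gate and qubit counts of the Kikuchi oracles -/

theorem HasOH.mono {N b : ℕ} {H : Matrix (Bits N) (Bits N) ℝ} {g q g' q' : ℝ}
    (h : HasOH H b g q) (hg : g ≤ g') (hq : q ≤ q') : HasOH H b g' q' := by
  obtain ⟨a, C, hC, hCg, hCq⟩ := h
  exact ⟨a, C, hC, hCg.trans hg, hCq.trans hq⟩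

theorem HasOF.mono {N s : ℕ} {H : Matrix (Bits N) (Bits N) ℝ} {g q g' q' : ℝ}
    (h : HasOF H s g q) (hg : g ≤ g') (hq : q ≤ q') : HasOF H s g' q' := by
  obtain ⟨a, C, hC, hCg, hCq⟩ := h
  exact ⟨a, C, hC, hCg.trans hg, hCq.trans hq⟩

/-- A bound, per `ℓ ln n`, on the number of qubits of the oracles. -/
noncomputable def qubitFactor (k : ℕ) (β : ℝ) : ℝ := 2560 * (k + 1) + β + 200

/-- A bound, per `m ℓ ln n`, on the number of gates of the oracles. -/
noncomputable def gateFactor (k : ℕ) (C a β : ℝ) : ℝ := 20 * (9 * C + 6 / a) * qubitFactor k β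

/-- At most C m scopes are visited, each at a cost linear in N + b. The bound N ≤ 4 ℓ ln n turns 640
into 2560, and additive constants are absorbed because ℓ ln n ≥ ln 2. -/
theorem hasOH_kikuchi {C a β : ℝ} (hC : 0 < C) (ha : 0 < a) (hβ : 0 < β) (hk : 0 < k)
    (hkℓ : k ≤ 2 * ℓ) (hn : 2 ≤ n) {m : ℝ≥0} {I : XORInstance n k} (hI : IsGood ℓ m C I) (Λ : ℝ)
    {b : ℕ} (hb : (b : ℝ) ≤ β * (ℓ * Real.log n)) :
    HasOH (kikuchiHamiltonian ℓ I Λ) b (gateFactor k C a β * (m * ℓ * Real.log n))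
      (qubitFactor k β * (ℓ * Real.log n)) := by
  have hlog := log_two_le_mul_log hn (show 0 < ℓ by omega)
  have hlog2 := Real.log_two_gt_d9
  have hN := numQubits_le (ℓ := ℓ) hn
  have hM : ((activeScopes I).card : ℝ) ≤ C * m :=
    le_trans (by exact_mod_cast card_activeScopes_le I) hI.2
  set Lg := ℓ * Real.log n with hLg
  have hk0 : (0 : ℝ) ≤ k := k.cast_nonneg
  have hkN := mul_le_mul_of_nonneg_left hN hk0
  have hkL : 0 ≤ k * Lg := mul_nonneg hk0 (by linarith)
  refine ((neighborPrograms_kikuchi hk hkℓ hn I Λ).hasOH b).mono ?_ ?_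
  · rw [Finset.length_toList]
    push_cast
    calc 5 * (((activeScopes I).card : ℝ) * (4 * (640 * (k + 1) * (numQubits n ℓ : ℝ) +
          8 * (numQubits n ℓ : ℝ) + 4) + (b + 2)))
        ≤ 5 * ((C * m) * (4 * (qubitFactor k β * Lg))) := by
          gcongr
          rw [qubitFactor]
          nlinarith
      _ ≤ gateFactor k C a β * (m * ℓ * Real.log n) := by
          have h0 : 0 ≤ m * (qubitFactor k β * Lg) := by
            have : 0 < qubitFactor k β := by rw [qubitFactor]; positivity
            have : 0 ≤ Lg := by linarith
            positivity
          have h1 : 0 < 6 / a := by positivity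
          have h2 : gateFactor k C a β * (m * ℓ * Real.log n) =
              20 * (9 * C + 6 / a) * (m * (qubitFactor k β * Lg)) := by
            rw [gateFactor, hLg]
            ring
          rw [h2]
          nlinarith [mul_nonneg hC.le h0, mul_nonneg h1.le h0]
  · push_cast
    rw [qubitFactor]
    nlinarith

theorem hasOF_kikuchi {C a β : ℝ} (hC : 0 < C) (ha : 0 < a) (hβ : 0 < β) (hk : 0 < k)
    (hkℓ : k ≤ 2 * ℓ) (hn : 2 ≤ n) {m : ℝ≥0} (hma : a * (ℓ * Real.log n) ≤ m)
    {I : XORInstance n k} (hI : IsGood ℓ m C I) (Λ : ℝ) {s : ℕ} (hs : s ≤ 2 ^ numQubits n ℓ)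
    (hsparse : IsSparse s (kikuchiMatrix ℓ I)) :
    HasOF (kikuchiHamiltonian ℓ I Λ) s (gateFactor k C a β * (m * ℓ * Real.log n))
      (qubitFactor k β * (ℓ * Real.log n)) := by
  have hlog := log_two_le_mul_log hn (show 0 < ℓ by omega)
  have hlog2 := Real.log_two_gt_d9
  have hN := numQubits_le (ℓ := ℓ) hn
  have hM : ((activeScopes I).card : ℝ) ≤ C * m :=
    le_trans (by exact_mod_cast card_activeScopes_le I) hI.2
  set Lg := ℓ * Real.log n with hLg
  have hk0 : (0 : ℝ) ≤ k := k.cast_nonneg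
  have hkN := mul_le_mul_of_nonneg_left hN hk0
  have hkL : 0 ≤ k * Lg := mul_nonneg hk0 (by linarith)
  have hβL : 0 ≤ β * Lg := mul_nonneg hβ.le (by linarith)
  refine ((neighborPrograms_kikuchi hk hkℓ hn I Λ).hasOF hs
    (length_matchedList_le (by omega) I hsparse)).mono ?_ ?_
  · rw [Finset.length_toList]
    push_cast
    -- The three closing maps do not scale with the number of scopes; m ≥ a Lg > a/2 charges them to
    -- m.
    have h3 : 3 ≤ 6 / a * (m : ℝ) := by
      rw [div_mul_eq_mul_div, le_div_iff₀ ha]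
      nlinarith
    calc 5 * ((9 * ((activeScopes I).card : ℝ) + 3) * (4 * (640 * (k + 1) * (numQubits n ℓ : ℝ) +
          20 * (numQubits n ℓ : ℝ) + 20) + (numQubits n ℓ : ℝ) + 1))
        ≤ 5 * ((9 * (C * m) + 6 / a * m) * (4 * (qubitFactor k β * Lg))) := by
          gcongr
          rw [qubitFactor]
          nlinarith
      _ = gateFactor k C a β * (m * ℓ * Real.log n) := by
          rw [gateFactor, hLg]
          ring
  · push_cast
    rw [qubitFactor]
    nlinarith

end Parameters

end Kikuchi

theorem mainTheorem7 (k : ℕ) (hk : Even k) (hk0 : 0 < k)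
    (A a β : ℝ) (hA : 0 < A) (ha : 0 < a) (hβ : 0 < β) :
    ∃ (C c C' : ℝ) (p : ℕ), 0 < C ∧ 0 < c ∧ 0 < C' ∧
      ∀ (n ℓ : ℕ) (hkn : k ≤ n) (m : ℝ≥0), k / 2 ≤ ℓ → ℓ ≤ n →
        (m : ℝ) / n ≤ A * ((n : ℝ) / ℓ) ^ (((k : ℝ) - 2) / 2) * Real.log n →
        a * (ℓ * Real.log n) ≤ (m : ℝ) →
        (∀ (z : Fin n → ℤˣ) (ρ : unitInterval),
          (Kikuchi.plantedPoisson hkn z m ρ).toOuterMeasure {I | ¬ Kikuchi.IsGood ℓ m C I} ≤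
            ENNReal.ofReal ((n : ℝ) ^ (-(c * ℓ)))) ∧
        ∀ I : Kikuchi.XORInstance n k, Kikuchi.IsGood ℓ m C I →
          ∀ Λ : ℝ, 0 < Λ → (∀ T U, |(Kikuchi.kikuchiMatrix ℓ I T U : ℝ)| ≤ Λ) →
            (∀ b : ℕ, (b : ℝ) ≤ β * (ℓ * Real.log n) →
              Kikuchi.HasOH (Kikuchi.kikuchiHamiltonian ℓ I Λ) b
                (C' * (m * ℓ * Real.log n) * Real.log (m * ℓ * Real.log n + 2) ^ p)
                (C' * (ℓ * Real.log n))) ∧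
            (∀ s : ℕ, (s : ℝ) ≤ C * (ℓ * Real.log n) → s ≤ 2 ^ Kikuchi.numQubits n ℓ →
              Kikuchi.IsSparse s (Kikuchi.kikuchiMatrix ℓ I) →
              Kikuchi.HasOF (Kikuchi.kikuchiHamiltonian ℓ I Λ) s
                (C' * (m * ℓ * Real.log n) * Real.log (m * ℓ * Real.log n + 2) ^ p)
                (C' * (ℓ * Real.log n))) := by
  obtain ⟨h, hkh⟩ := hk
  have hkh' : k = 2 * h := by omega
  have hC : 0 < 5 + 2 / a + 2 * (A * (k : ℝ) ^ k) := by positivity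
  have hq : 0 < Kikuchi.qubitFactor k β := by
    unfold Kikuchi.qubitFactor
    positivity
  have hg : 0 < Kikuchi.gateFactor k (5 + 2 / a + 2 * (A * (k : ℝ) ^ k)) a β := by
    unfold Kikuchi.gateFactor
    positivity
  -- One constant C' serves for gates and for qubits, being the sum of the two factors; the exponent
  -- p of the logarithm is 0.
  refine ⟨5 + 2 / a + 2 * (A * (k : ℝ) ^ k), 1,
    Kikuchi.gateFactor k (5 + 2 / a + 2 * (A * (k : ℝ) ^ k)) a β + Kikuchi.qubitFactor k β, 0,
    hC, one_pos, by positivity, ?_⟩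
  intro n ℓ hkn m hkℓ _ hm hma
  have hlog : 0 ≤ Real.log n := Real.log_natCast_nonneg n
  refine ⟨fun z ρ => Kikuchi.plantedPoisson_not_isGood_le hA ha hkh' (by omega) hkn (by omega)
    hm hma z ρ, fun I hI Λ _ _ => ⟨fun b hb => ?_, fun s _ hs hsparse => ?_⟩⟩
  · refine (Kikuchi.hasOH_kikuchi hC ha hβ hk0 (by omega) (by omega) hI Λ hb).mono ?_ ?_
    · rw [pow_zero, mul_one]
      exact mul_le_mul_of_nonneg_right (by linarith) (by positivity)
    · exact mul_le_mul_of_nonneg_right (by linarith) (by positivity)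
  · refine (Kikuchi.hasOF_kikuchi hC ha hβ hk0 (by omega) (by omega) hma hI Λ hs hsparse).mono
      ?_ ?_
    · rw [pow_zero, mul_one]
      exact mul_le_mul_of_nonneg_right (by linarith) (by positivity)
    · exact mul_le_mul_of_nonneg_right (by linarith) (by positivity)
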